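/- Let $k$ be an algebraically closed field of characteristic zero and $G$ a finite group. Let $(X,\rhd)$ be a rack (a nonempty set with all maps $\phi_i=i\rhd-$ bijective and $i\rhd(j\rhd l)=(i\rhd j)\rhd(i\rhd l)$) and let $q:X\times X\to k^*$ be a rack 2-cocycle, i.e. $q_{i,j\rhd l}\,q_{j,l}=q_{i\rhd j,i\rhd l}\,q_{i,l}$. Let $(\cdot,g,\{\chi_i\}_{i\in X})$ be a faithful principal YD-realization of $(X,q)$ over $G$: an action $\cdot$ of $G$ on $X$, an injective map $g:X\to G$ and maps $\chi_i:G\to k^*$ such that, for all $i,j\in X$ and $h,t\in G$, $g_{h\cdot i}=hg_ih^{-1}$, $g_i\cdot j=i\rhd j$, $\chi_i(ht)=\chi_{t\cdot i}(h)\chi_i(t)$ and $\chi_i(g_j)=q_{ji}$. Let $V(X,q)$ be the Yetter-Drinfeld module over $kG$ with basis $\{x_i\}_{i\in X}$, action $t\cdot x_i=\chi_i(t)x_{t\cdot i}$ and coaction $x_i\mapsto g_i\otimes x_i$. Let $T(X,q)$ be its tensor algebra, a Hopf algebra in the braided category of Yetter-Drinfeld modules over $kG$ in which each $x_i$ is primitive,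 and let $\mathcal J(X,q)$ be the largest Hopf ideal of $T(X,q)$ (in that category) which is generated as an ideal by homogeneous elements of degree $\ge 2$, so that $\mathcal B(X,q)=T(X,q)/\mathcal J(X,q)$ is the Nichols algebra of $V(X,q)$. Let $X^*=(X,\rhd^{-1})$ be the dual rack, $i\rhd^{-1}j=\phi_i^{-1}(j)$, with the 2-cocycle $q^{-*}_{i,j}=(q_{i,\,i\rhd^{-1}j})^{-1}$. Then $(\cdot,g^{-1},\{\chi_i\}_{i\in X})$ is a principal YD-realization of $(X^*,q^{-*})$ over $G$; let $V(X^*,q^{-*})$, with basis $\{y_i\}_{i\in X}$, $T(X^*,q^{-*})$ and $\mathcal J(X^*,q^{-*})$ be defined by it as above. Let $\mathfrak c:T(X,q)\to T(X^*,q^{-*})$ be the unique linear map such that $\mathfrak c(1)=1$, $\mathfrak c(x_i)=y_i$ for $i\in X$, and $\mathfrak c(m\,r)=\mathfrak c(m_{(0)})\,(m_{(-1)}\cdot\mathfrak c(r))$ for all $m,r\in T(X,q)$, where $m\mapsto m_{(-1)}\otimes m_{(0)}$ is the coaction of $kG$. Then: 1. $\mathcal J(X^*,q^{-*})=\mathfrak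 c(\mathcal J(X,q))$. 2. If $S$ is a set which generates $\mathcal J(X,q)$ as a two-sided ideal, and either all elements of $S$ are homogeneous with respect to the tensor degree or the linear span of $S$ is a Yetter-Drinfeld submodule of $T(X,q)$, then $\mathfrak c(S)$ generates $\mathcal J(X^*,q^{-*})$ as a two-sided ideal. 3. If $S$ is any set which generates $\mathcal J(X,q)$ in the category of Yetter-Drinfeld modules (i.e. $\mathcal J(X,q)$ is the smallest two-sided ideal of $T(X,q)$ which is a Yetter-Drinfeld submodule and contains $S$), then $\mathfrak c(S)$ generates $\mathcal J(X^*,q^{-*})$ in the same sense. -/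

import Mathlib

open scoped TensorProduct Quandles

namespace NicholsRack

noncomputable section

/-- A left-left Yetter-Drinfeld module over the group algebra of `G`, with underlying space `V`:
a `G`-action `h · v`, a coaction `v ↦ v₍₋₁₎ ⊗ v₍₀₎` and the compatibility
`(h · v)₍₋₁₎ ⊗ (h · v)₍₀₎ = h v₍₋₁₎ h⁻¹ ⊗ h · v₍₀₎`. -/
structure YDModule (k G V : Type*) [Field k] [Group G] [AddCommGroup V] [Module k V] where
  act : Representation k G V
  coact : V →ₗ[k] MonoidAlgebra k G ⊗[k] V
  coassoc : (TensorProduct.assoc k (MonoidAlgebra k G) (MonoidAlgebra k G) V).toLinearMap ∘ₗ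
      (Coalgebra.comul (R := k) (A := MonoidAlgebra k G)).rTensor V ∘ₗ coact =
    coact.lTensor (MonoidAlgebra k G) ∘ₗ coact
  counit : (TensorProduct.lid k V).toLinearMap ∘ₗ
      (Coalgebra.counit (R := k) (A := MonoidAlgebra k G)).rTensor V ∘ₗ coact = LinearMap.id
  compat : ∀ h : G, coact ∘ₗ act h =
    TensorProduct.map
      (MonoidAlgebra.mapDomainAlgHom k k (MulAut.conj h).toMonoidHom).toLinearMap (act h) ∘ₗ coact

namespace YDModule

variable {k G V N : Type*} [Field k] [Group G] [AddCommGroup V] [Module k V]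
  [AddCommGroup N] [Module k N]

/-- A Yetter-Drinfeld submodule: a subspace stable under the action and the coaction. -/
structure IsSub (M : YDModule k G V) (W : Submodule k V) : Prop where
  act_mem : ∀ h : G, ∀ w ∈ W, M.act h w ∈ W
  coact_mem : ∀ w ∈ W, M.coact w ∈ Submodule.map₂ (TensorProduct.mk k (MonoidAlgebra k G) V) ⊤ W

/-- The braiding `v ⊗ n ↦ v₍₋₁₎ · n ⊗ v₍₀₎`. -/
def braid (M : YDModule k G V) (ρ : Representation k G N) : V ⊗[k] N →ₗ[k] N ⊗[k] V :=
  (TensorProduct.lift ρ.asAlgebraHom.toLinearMap).rTensor V ∘ₗ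
    (TensorProduct.rightComm k (MonoidAlgebra k G) V N).toLinearMap ∘ₗ M.coact.rTensor N

/-- Elements of degree `g`, that is, `v₍₋₁₎ ⊗ v₍₀₎ = g ⊗ v`. -/
def IsDeg (M : YDModule k G V) (g : G) (v : V) : Prop :=
  M.coact v = MonoidAlgebra.single g (1 : k) ⊗ₜ[k] v

theorem braid_of_isDeg (M : YDModule k G V) (ρ : Representation k G N) {g : G} {v : V}
    (hv : M.IsDeg g v) (n : N) : M.braid ρ (v ⊗ₜ n) = ρ g n ⊗ₜ v := by
  unfold IsDeg at hv
  simp [braid, hv]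

theorem span_isDeg [Finite G] (M : YDModule k G V) :
    Submodule.span k {v : V | ∃ g : G, M.IsDeg g v} = ⊤ := by
  classical
  cases nonempty_fintype G
  let c : G → MonoidAlgebra k G →ₗ[k] k := fun g =>
    Finsupp.lapply g ∘ₗ (MonoidAlgebra.coeffLinearEquiv k).toLinearMap
  let p : G → V →ₗ[k] V := fun g => (TensorProduct.lid k V).toLinearMap ∘ₗ (c g).rTensor V ∘ₗ M.coact
  rw [eq_top_iff]
  intro v _
  have hsum : (Coalgebra.counit (R := k) (A := MonoidAlgebra k G)) = ∑ g, c g := by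
    ext a
    simp [c, Finsupp.single_apply]
  have hv : v = ∑ g, p g v := by
    have h := LinearMap.congr_fun M.counit v
    rw [hsum, ← LinearMap.coe_rTensorHom, map_sum] at h
    simp only [LinearMap.comp_apply, LinearMap.id_apply, LinearMap.coe_sum, Finset.sum_apply,
      map_sum] at h
    exact h.symm
  have hp : ∀ g, M.IsDeg g (p g v) := by
    intro g
    let F := (TensorProduct.lid k (MonoidAlgebra k G ⊗[k] V)).toLinearMap ∘ₗ
      (c g).rTensor (MonoidAlgebra k G ⊗[k] V)
    have h1 : ∀ t : MonoidAlgebra k G ⊗[k] V,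
        F ((TensorProduct.assoc k (MonoidAlgebra k G) (MonoidAlgebra k G) V)
          ((Coalgebra.comul (R := k) (A := MonoidAlgebra k G)).rTensor V t)) =
        MonoidAlgebra.single g (1 : k) ⊗ₜ[k] (TensorProduct.lid k V ((c g).rTensor V t)) := by
      intro t
      induction t with
      | zero => simp
      | add a b ha hb => simp only [map_add, ha, hb, TensorProduct.tmul_add]
      | tmul a w =>
        induction a using MonoidAlgebra.induction_linear with
        | zero => simp
        | add a b ha hb => simp only [TensorProduct.add_tmul, map_add, ha, hb, TensorProduct.tmul_add]
        | single x r =>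
          by_cases hx : x = g
          · subst hx
            simp [F, c, TensorProduct.smul_tmul']
          · simp [F, c, hx]
    have h2 : ∀ t : MonoidAlgebra k G ⊗[k] V,
        F (M.coact.lTensor (MonoidAlgebra k G) t) =
          M.coact (TensorProduct.lid k V ((c g).rTensor V t)) := by
      intro t
      induction t with
      | zero => simp
      | add a b ha hb => simp only [map_add, ha, hb]
      | tmul a w => simp [F]
    have h3 := LinearMap.congr_fun M.coassoc v
    simp only [LinearMap.comp_apply, LinearEquiv.coe_coe] at h3
    have h4 := congrArg F h3
    rw [h1, h2] at h4
    exact h4.symm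
  rw [hv]
  exact Submodule.sum_mem _ fun g _ => Submodule.subset_span ⟨g, hp g⟩

/-- To prove a linear statement it is enough to treat elements having a degree. -/
theorem isDeg_induction [Finite G] (M : YDModule k G V) {P : V → Prop}
    (hdeg : ∀ g v, M.IsDeg g v → P v) (hzero : P 0) (hadd : ∀ a b, P a → P b → P (a + b))
    (hsmul : ∀ (r : k) a, P a → P (r • a)) (v : V) : P v := by
  have hv : v ∈ Submodule.span k {v : V | ∃ g : G, M.IsDeg g v} := by
    rw [M.span_isDeg]; trivial
  induction hv using Submodule.span_induction with
  | mem x hx => obtain ⟨g, hg⟩ := hx; exact hdeg g x hg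
  | zero => exact hzero
  | add x y _ _ hx hy => exact hadd x y hx hy
  | smul r x _ hx => exact hsmul r x hx

theorem IsDeg.act {M : YDModule k G V} {g : G} {v : V} (hv : M.IsDeg g v) (h : G) :
    M.IsDeg (h * g * h⁻¹) (M.act h v) := by
  have h1 := LinearMap.congr_fun (M.compat h) v
  unfold IsDeg at hv ⊢
  simp only [LinearMap.comp_apply] at h1
  rw [h1, hv]
  simp

/-- The action on the tensor algebra, by algebra automorphisms extending the action on `V`. -/
def tensorAct (M : YDModule k G V) (h : G) : TensorAlgebra k V →ₐ[k] TensorAlgebra k V :=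
  TensorAlgebra.lift k (TensorAlgebra.ι k ∘ₗ M.act h)

/-- The coaction on the tensor algebra, as the algebra map extending the coaction on `V`. -/
def tensorCoact (M : YDModule k G V) :
    TensorAlgebra k V →ₐ[k] MonoidAlgebra k G ⊗[k] TensorAlgebra k V :=
  TensorAlgebra.lift k ((TensorAlgebra.ι k).lTensor (MonoidAlgebra k G) ∘ₗ M.coact)

@[simp]
theorem tensorAct_ι (M : YDModule k G V) (h : G) (v : V) :
    M.tensorAct h (TensorAlgebra.ι k v) = TensorAlgebra.ι k (M.act h v) := by
  simp [tensorAct]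

theorem tensorCoact_ι (M : YDModule k G V) (v : V) :
    M.tensorCoact (TensorAlgebra.ι k v) =
      (TensorAlgebra.ι k).lTensor (MonoidAlgebra k G) (M.coact v) := by
  simp [tensorCoact]

theorem tensorCoact_induction [Finite G] (M : YDModule k G V) {P : TensorAlgebra k V → Prop}
    (hone : P 1)
    (hmul : ∀ g v h t, M.IsDeg g v →
      M.tensorCoact t = MonoidAlgebra.single h (1 : k) ⊗ₜ[k] t → P t →
      M.tensorCoact (TensorAlgebra.ι k v * t) =
        MonoidAlgebra.single (g * h) (1 : k) ⊗ₜ[k] (TensorAlgebra.ι k v * t) →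
      P (TensorAlgebra.ι k v * t))
    (hadd : ∀ a b, P a → P b → P (a + b))
    (hsmul : ∀ (r : k) a, P a → P (r • a)) (t : TensorAlgebra k V) : P t := by
  let S : Set (TensorAlgebra k V) :=
    {t | (∃ h : G, M.tensorCoact t = MonoidAlgebra.single h (1 : k) ⊗ₜ[k] t) ∧ P t}
  have hzero : P 0 := by simpa using hsmul 0 1 hone
  have h1 : (1 : TensorAlgebra k V) ∈ Submodule.span k S :=
    Submodule.subset_span ⟨⟨1, by rw [map_one]; rfl⟩, hone⟩
  have hι : ∀ (v : V) (t), t ∈ Submodule.span k S → TensorAlgebra.ι k v * t ∈ Submodule.span k S := by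
    intro v t ht
    induction v using M.isDeg_induction with
    | hdeg g v hv =>
      induction ht using Submodule.span_induction with
      | mem t ht =>
        obtain ⟨⟨h, hh⟩, hP⟩ := ht
        have : M.tensorCoact (TensorAlgebra.ι k v * t) =
            MonoidAlgebra.single (g * h) (1 : k) ⊗ₜ[k] (TensorAlgebra.ι k v * t) := by
          unfold IsDeg at hv
          rw [map_mul, tensorCoact_ι, hv, hh]
          simp [MonoidAlgebra.single_mul_single]
        exact Submodule.subset_span ⟨⟨g * h, this⟩, hmul g v h t hv hh hP this⟩
      | zero => simp
      | add x y _ _ hx hy => rw [mul_add]; exact add_mem hx hy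
      | smul r x _ hx => rw [mul_smul_comm]; exact Submodule.smul_mem _ _ hx
    | hzero => simp
    | hadd a b ha hb => rw [map_add, add_mul]; exact add_mem ha hb
    | hsmul r a ha => rw [map_smul, smul_mul_assoc]; exact Submodule.smul_mem _ _ ha
  have hall : ∀ s t : TensorAlgebra k V, t ∈ Submodule.span k S → s * t ∈ Submodule.span k S := by
    intro s
    induction s using TensorAlgebra.induction with
    | algebraMap r =>
      intro t ht
      rw [← Algebra.smul_def]; exact Submodule.smul_mem _ _ ht
    | ι v => exact hι v
    | mul a b ha hb => intro t ht; rw [mul_assoc]; exact ha _ (hb _ ht)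
    | add a b ha hb => intro t ht; rw [add_mul]; exact add_mem (ha _ ht) (hb _ ht)
  have ht := hall t 1 h1
  rw [mul_one] at ht
  induction ht using Submodule.span_induction with
  | mem x hx => exact hx.2
  | zero => exact hzero
  | add x y _ _ hx hy => exact hadd x y hx hy
  | smul r x _ hx => exact hsmul r x hx

/-- The tensor algebra `T(V)` as a Yetter-Drinfeld module. -/
def tensor [Finite G] (M : YDModule k G V) : YDModule k G (TensorAlgebra k V) where
  act :=
    { toFun := fun h => (M.tensorAct h).toLinearMap
      map_one' := by
        have : M.tensorAct 1 = AlgHom.id k _ := by ext v; simp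
        rw [this]; rfl
      map_mul' := fun a b => by
        have : M.tensorAct (a * b) = (M.tensorAct a).comp (M.tensorAct b) := by ext v; simp
        rw [this]; rfl }
  coact := M.tensorCoact.toLinearMap
  coassoc := by
    ext t
    induction t using M.tensorCoact_induction with
    | hone => simp [Algebra.TensorProduct.one_def, MonoidAlgebra.one_def]
    | hmul g v h t _ _ _ ht => simp [ht]
    | hadd a b ha hb => simp only [map_add, ha, hb]
    | hsmul r a ha => simp only [map_smul, ha]
  counit := by
    ext t
    induction t using M.tensorCoact_induction with
    | hone => simp [Algebra.TensorProduct.one_def, MonoidAlgebra.one_def]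
    | hmul g v h t _ _ _ ht => simp [ht]
    | hadd a b ha hb => simp only [map_add, ha, hb]
    | hsmul r a ha => simp only [map_smul, ha]
  compat := fun h => by
    have : M.tensorCoact.comp (M.tensorAct h) =
        (Algebra.TensorProduct.map (MonoidAlgebra.mapDomainAlgHom k k (MulAut.conj h).toMonoidHom)
          (M.tensorAct h)).comp M.tensorCoact := by
      ext v
      simp only [LinearMap.comp_apply, AlgHom.toLinearMap_apply, AlgHom.comp_apply, tensorAct_ι,
        tensorCoact_ι]
      have := LinearMap.congr_fun (M.compat h) v
      simp only [LinearMap.comp_apply] at this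
      rw [this]
      induction M.coact v with
      | zero => simp
      | add a b ha hb => simp only [map_add, ha, hb]
      | tmul a w => simp
    ext t
    exact DFunLike.congr_fun this t

@[simp]
theorem tensor_act [Finite G] (M : YDModule k G V) (h : G) (t : TensorAlgebra k V) :
    M.tensor.act h t = M.tensorAct h t := rfl

section HopfStructure

variable [Finite G] (M : YDModule k G V)

/-- The multiplication `(m ⊗ m) ∘ (id ⊗ c ⊗ id)` of the braided tensor square `T(V) ⊗ T(V)`. -/
def sqMul : (TensorAlgebra k V ⊗[k] TensorAlgebra k V) ⊗[k]
    (TensorAlgebra k V ⊗[k] TensorAlgebra k V) →ₗ[k] TensorAlgebra k V ⊗[k] TensorAlgebra k V :=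
  let T := TensorAlgebra k V
  TensorProduct.map (LinearMap.mul' k T) (LinearMap.mul' k T) ∘ₗ
    (TensorProduct.assoc k T T (T ⊗[k] T)).symm.toLinearMap ∘ₗ
    (TensorProduct.assoc k T T T).toLinearMap.lTensor T ∘ₗ
    ((M.tensor.braid M.tensor.act).rTensor T).lTensor T ∘ₗ
    (TensorProduct.assoc k T T T).symm.toLinearMap.lTensor T ∘ₗ
    (TensorProduct.assoc k T T (T ⊗[k] T)).toLinearMap

/-- The coproduct of `T(V)`: the algebra map from `T(V)` to the braided tensor square with
`Δ(v) = v ⊗ 1 + 1 ⊗ v`, computed from `Δ(v t) = Δ(v) Δ(t)` and `Δ(1) = 1 ⊗ 1`;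
see `comul_one`, `comul_ι`, `comul_mul`. -/
def comul : TensorAlgebra k V →ₗ[k] TensorAlgebra k V ⊗[k] TensorAlgebra k V :=
  LinearMap.applyₗ (1 ⊗ₜ[k] 1) ∘ₗ
    (TensorAlgebra.lift k (A := Module.End k (TensorAlgebra k V ⊗[k] TensorAlgebra k V))
      (TensorProduct.curry M.sqMul ∘ₗ
        ((TensorProduct.mk k (TensorAlgebra k V) (TensorAlgebra k V)).flip 1 +
          TensorProduct.mk k (TensorAlgebra k V) (TensorAlgebra k V) 1) ∘ₗ
        TensorAlgebra.ι k)).toLinearMap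

/-- The antipode of `T(V)`: the braided anti-algebra map with `S(v) = -v`, computed from
`S(v t) = m (c (S(v) ⊗ S(t)))` and `S(1) = 1`;
see `antipode_one`, `antipode_ι`, `antipode_mul`. -/
def antipode : TensorAlgebra k V →ₗ[k] TensorAlgebra k V :=
  LinearMap.applyₗ 1 ∘ₗ
    (TensorAlgebra.lift k (A := Module.End k (TensorAlgebra k V))
      (TensorProduct.curry (LinearMap.mul' k (TensorAlgebra k V) ∘ₗ
        M.tensor.braid M.tensor.act) ∘ₗ (-TensorAlgebra.ι k))).toLinearMap

variable {M}

theorem IsDeg.tensor_ι {g : G} {v : V} (hv : M.IsDeg g v) :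
    M.tensor.IsDeg g (TensorAlgebra.ι k v) := by
  unfold IsDeg at hv
  change M.tensorCoact _ = _
  rw [tensorCoact_ι, hv]; simp

theorem tensor_isDeg_one : M.tensor.IsDeg 1 1 := map_one M.tensorCoact

theorem IsDeg.tensor_mul {g h : G} {a b : TensorAlgebra k V} (ha : M.tensor.IsDeg g a)
    (hb : M.tensor.IsDeg h b) : M.tensor.IsDeg (g * h) (a * b) := by
  change M.tensorCoact _ = _ at ha hb ⊢
  rw [map_mul, ha, hb]
  simp [MonoidAlgebra.single_mul_single]

theorem sqMul_of_isDeg {g : G} {b : TensorAlgebra k V} (hb : M.tensor.IsDeg g b)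
    (a a' b' : TensorAlgebra k V) :
    M.sqMul ((a ⊗ₜ b) ⊗ₜ (a' ⊗ₜ b')) = (a * M.tensorAct g a') ⊗ₜ (b * b') := by
  simp [sqMul, braid_of_isDeg _ _ hb]

variable (M)

theorem sqMul_one_left (x : TensorAlgebra k V ⊗[k] TensorAlgebra k V) :
    M.sqMul ((1 ⊗ₜ 1) ⊗ₜ x) = x := by
  induction x with
  | zero => simp
  | add a b ha hb => rw [TensorProduct.tmul_add, map_add, ha, hb]
  | tmul a b =>
    rw [sqMul_of_isDeg tensor_isDeg_one]
    have : M.tensorAct 1 = AlgHom.id k _ := by ext v; simp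
    simp [this]

theorem sqMul_one_right (x : TensorAlgebra k V ⊗[k] TensorAlgebra k V) :
    M.sqMul (x ⊗ₜ (1 ⊗ₜ 1)) = x := by
  induction x with
  | zero => simp
  | add a b ha hb => rw [TensorProduct.add_tmul, map_add, ha, hb]
  | tmul a b =>
    induction b using M.tensor.isDeg_induction with
    | hdeg g b hb => rw [sqMul_of_isDeg hb]; simp
    | hzero => simp
    | hadd b b' hb hb' => rw [TensorProduct.tmul_add, TensorProduct.add_tmul, map_add, hb, hb']
    | hsmul r b hb => rw [TensorProduct.tmul_smul, ← TensorProduct.smul_tmul', map_smul, hb]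

/-- The braided tensor square is associative. -/
theorem sqMul_assoc (x y z : TensorAlgebra k V ⊗[k] TensorAlgebra k V) :
    M.sqMul (M.sqMul (x ⊗ₜ y) ⊗ₜ z) = M.sqMul (x ⊗ₜ M.sqMul (y ⊗ₜ z)) := by
  induction z with
  | zero => simp
  | add a b ha hb => simp only [TensorProduct.tmul_add, map_add, ha, hb]
  | tmul a'' b'' =>
  induction y with
  | zero => simp
  | add a b ha hb => simp only [TensorProduct.tmul_add, TensorProduct.add_tmul, map_add, ha, hb]
  | tmul a' b' =>
  induction x with
  | zero => simp
  | add a b ha hb => simp only [TensorProduct.add_tmul, map_add, ha, hb]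
  | tmul a b =>
  induction b using M.tensor.isDeg_induction with
  | hzero => simp
  | hadd b c hb hc => simp only [TensorProduct.tmul_add, TensorProduct.add_tmul, map_add, hb, hc]
  | hsmul r b hb =>
    simp only [TensorProduct.tmul_smul, ← TensorProduct.smul_tmul', map_smul, hb]
  | hdeg g b hb =>
  induction b' using M.tensor.isDeg_induction with
  | hzero => simp
  | hadd b c hb hc => simp only [TensorProduct.tmul_add, TensorProduct.add_tmul, map_add, hb, hc]
  | hsmul r b hb =>
    simp only [TensorProduct.tmul_smul, ← TensorProduct.smul_tmul', map_smul, hb]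
  | hdeg g' b' hb' =>
    rw [sqMul_of_isDeg hb, sqMul_of_isDeg hb', sqMul_of_isDeg hb, sqMul_of_isDeg (hb.tensor_mul hb')]
    have : M.tensorAct (g * g') = (M.tensorAct g).comp (M.tensorAct g') := by ext v; simp
    simp [this, mul_assoc]

theorem comul_one : M.comul 1 = 1 ⊗ₜ 1 := by
  simp [comul]

theorem comul_ι_mul (v : V) (t : TensorAlgebra k V) : M.comul (TensorAlgebra.ι k v * t) =
    M.sqMul ((TensorAlgebra.ι k v ⊗ₜ 1 + 1 ⊗ₜ TensorAlgebra.ι k v) ⊗ₜ M.comul t) := by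
  simp [comul, TensorProduct.add_tmul]

theorem comul_ι (v : V) : M.comul (TensorAlgebra.ι k v) =
    TensorAlgebra.ι k v ⊗ₜ 1 + 1 ⊗ₜ TensorAlgebra.ι k v := by
  have := M.comul_ι_mul v 1
  rwa [mul_one, comul_one, sqMul_one_right] at this

theorem comul_mul (s t : TensorAlgebra k V) :
    M.comul (s * t) = M.sqMul (M.comul s ⊗ₜ M.comul t) := by
  induction s using M.tensorCoact_induction with
  | hone => rw [one_mul, comul_one, sqMul_one_left]
  | hmul g v h s _ _ hs _ => rw [mul_assoc, comul_ι_mul, hs, comul_ι_mul, sqMul_assoc]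
  | hadd a b ha hb => simp only [add_mul, map_add, ha, hb, TensorProduct.add_tmul]
  | hsmul r a ha => simp only [smul_mul_assoc, map_smul, ha, ← TensorProduct.smul_tmul']

theorem antipode_one : M.antipode 1 = 1 := by
  simp [antipode]

theorem antipode_ι_mul {g : G} {v : V} (hv : M.IsDeg g v) (t : TensorAlgebra k V) :
    M.antipode (TensorAlgebra.ι k v * t) =
      -(M.tensorAct g (M.antipode t) * TensorAlgebra.ι k v) := by
  simp [antipode, braid_of_isDeg _ _ hv.tensor_ι]

theorem antipode_ι (v : V) : M.antipode (TensorAlgebra.ι k v) = -TensorAlgebra.ι k v := by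
  induction v using M.isDeg_induction with
  | hdeg g v hv => simpa [antipode_one] using M.antipode_ι_mul hv 1
  | hzero => simp
  | hadd a b ha hb => rw [map_add, map_add, ha, hb]; abel
  | hsmul r a ha => simp [ha]

theorem antipode_act (h : G) (t : TensorAlgebra k V) :
    M.antipode (M.tensorAct h t) = M.tensorAct h (M.antipode t) := by
  induction t using M.tensorCoact_induction with
  | hone => simp [antipode_one]
  | hmul g v h' t hv _ ht _ =>
    rw [map_mul, tensorAct_ι, antipode_ι_mul _ (hv.act h), ht, antipode_ι_mul _ hv, map_neg, map_mul,
      tensorAct_ι]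
    have h1 : ∀ a b x, M.tensorAct (a * b) x = M.tensorAct a (M.tensorAct b x) := by
      intro a b x
      have : M.tensorAct (a * b) = (M.tensorAct a).comp (M.tensorAct b) := by ext v; simp
      rw [this]; rfl
    rw [← h1, ← h1]
    simp
  | hadd a b ha hb => simp only [map_add, ha, hb]
  | hsmul r a ha => simp only [map_smul, ha]

theorem IsDeg.antipode {M : YDModule k G V} {h : G} {t : TensorAlgebra k V}
    (ht : M.tensor.IsDeg h t) : M.tensor.IsDeg h (M.antipode t) := by
  have key : ∀ t, M.tensor.coact (M.antipode t) =
      M.antipode.lTensor (MonoidAlgebra k G) (M.tensor.coact t) := by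
    intro t
    induction t using M.tensorCoact_induction with
    | hone =>
      have h1 := tensor_isDeg_one (M := M)
      unfold IsDeg at h1
      simp [antipode_one, h1]
    | hmul g v h t hv ht0 ht hvt =>
      have ht' : M.tensor.IsDeg h (M.antipode t) := by
        change M.tensor.coact t = _ at ht0
        rw [IsDeg, ht, ht0]; simp
      change M.tensor.coact _ = _ at hvt
      have h2 := (ht'.act g).tensor_mul hv.tensor_ι
      rw [inv_mul_cancel_right] at h2
      rw [hvt, antipode_ι_mul _ hv, map_neg]
      simp only [LinearMap.lTensor_tmul]
      rw [antipode_ι_mul _ hv, TensorProduct.tmul_neg]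
      exact congrArg Neg.neg h2
    | hadd a b ha hb => simp only [map_add, ha, hb]
    | hsmul r a ha => simp only [map_smul, ha]
  unfold IsDeg at ht ⊢
  rw [key, ht]; simp

theorem antipode_mul (s t : TensorAlgebra k V) : M.antipode (s * t) =
    LinearMap.mul' k (TensorAlgebra k V)
      (M.tensor.braid M.tensor.act (M.antipode s ⊗ₜ M.antipode t)) := by
  induction s using M.tensorCoact_induction with
  | hone =>
    rw [one_mul, antipode_one, braid_of_isDeg _ _ tensor_isDeg_one]
    simp
  | hmul g v h s hv hs0 hs hvs =>
    have hs1 : M.tensor.IsDeg h (M.antipode s) := IsDeg.antipode hs0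
    have hs2 : M.tensor.IsDeg (g * h) (M.antipode (TensorAlgebra.ι k v * s)) := IsDeg.antipode hvs
    rw [mul_assoc, antipode_ι_mul _ hv, hs, braid_of_isDeg _ _ hs1, braid_of_isDeg _ _ hs2,
      antipode_ι_mul _ hv]
    simp [mul_assoc]
  | hadd a b ha hb => simp only [add_mul, map_add, ha, hb, TensorProduct.add_tmul]
  | hsmul r a ha => simp only [smul_mul_assoc, map_smul, ha, ← TensorProduct.smul_tmul']

theorem mul_antipode_rTensor_comul (t : TensorAlgebra k V) :
    LinearMap.mul' k (TensorAlgebra k V) (M.antipode.rTensor (TensorAlgebra k V) (M.comul t)) =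
      algebraMap k (TensorAlgebra k V) (TensorAlgebra.algebraMapInv t) := by
  induction t using M.tensorCoact_induction with
  | hone => simp [comul_one, antipode_one]
  | hmul g v h t hv _ _ _ =>
    rw [comul_ι_mul, map_mul]
    have h0 : TensorAlgebra.algebraMapInv (TensorAlgebra.ι k v) = (0 : k) := by
      simp [TensorAlgebra.algebraMapInv]
    rw [h0, zero_mul, map_zero]
    induction M.comul t with
    | zero => simp
    | add a b ha hb => rw [TensorProduct.tmul_add, map_add, map_add, map_add, ha, hb, add_zero]
    | tmul a b =>
      rw [TensorProduct.add_tmul, map_add, sqMul_of_isDeg tensor_isDeg_one,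
        sqMul_of_isDeg hv.tensor_ι]
      have : M.tensorAct 1 = AlgHom.id k _ := by ext v; simp
      simp [this, antipode_ι_mul _ hv, antipode_act, mul_assoc]
  | hadd a b ha hb => simp only [map_add, ha, hb]
  | hsmul r a ha => rw [map_smul, map_smul, map_smul, map_smul, ha, smul_eq_mul, map_mul, Algebra.smul_def]

theorem mul_antipode_lTensor_comul (t : TensorAlgebra k V) :
    LinearMap.mul' k (TensorAlgebra k V) (M.antipode.lTensor (TensorAlgebra k V) (M.comul t)) =
      algebraMap k (TensorAlgebra k V) (TensorAlgebra.algebraMapInv t) := by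
  induction t using M.tensorCoact_induction with
  | hone => simp [comul_one, antipode_one]
  | hmul g v h t hv _ ht _ =>
    have h0 : TensorAlgebra.algebraMapInv (TensorAlgebra.ι k v) = (0 : k) := by
      simp [TensorAlgebra.algebraMapInv]
    have key : ∀ x : TensorAlgebra k V ⊗[k] TensorAlgebra k V,
        LinearMap.mul' k (TensorAlgebra k V) (M.antipode.lTensor (TensorAlgebra k V)
          (M.sqMul ((TensorAlgebra.ι k v ⊗ₜ 1 + 1 ⊗ₜ TensorAlgebra.ι k v) ⊗ₜ x))) =
        TensorAlgebra.ι k v *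
            LinearMap.mul' k (TensorAlgebra k V) (M.antipode.lTensor (TensorAlgebra k V) x) -
          M.tensorAct g
            (LinearMap.mul' k (TensorAlgebra k V) (M.antipode.lTensor (TensorAlgebra k V) x)) *
            TensorAlgebra.ι k v := by
      intro x
      induction x with
      | zero => simp
      | add a b ha hb =>
        simp only [TensorProduct.tmul_add, map_add, ha, hb, mul_add, add_mul]; abel
      | tmul a b =>
        rw [TensorProduct.add_tmul, map_add, sqMul_of_isDeg tensor_isDeg_one,
          sqMul_of_isDeg hv.tensor_ι]
        have : M.tensorAct 1 = AlgHom.id k _ := by ext v; simp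
        simp [this, antipode_ι_mul _ hv, mul_assoc, sub_eq_add_neg]
    rw [comul_ι_mul, key, ht, map_mul, h0, zero_mul, map_zero, AlgHom.commutes,
      Algebra.commutes, sub_self]
  | hadd a b ha hb => simp only [map_add, ha, hb]
  | hsmul r a ha => rw [map_smul, map_smul, map_smul, map_smul, ha, smul_eq_mul, map_mul, Algebra.smul_def]

end HopfStructure

section NicholsIdeal

/-- The subspace underlying a two-sided ideal. -/
def toSub (I : TwoSidedIdeal (TensorAlgebra k V)) : Submodule k (TensorAlgebra k V) :=
  (TwoSidedIdeal.asIdeal I).restrictScalars k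

@[simp]
theorem mem_toSub {I : TwoSidedIdeal (TensorAlgebra k V)} {x : TensorAlgebra k V} :
    x ∈ toSub I ↔ x ∈ I := Iff.rfl

/-- `x` is homogeneous of tensor degree `n`, that is, `x ∈ V^{⊗ n}`. -/
def IsHomogeneous (n : ℕ) (x : TensorAlgebra k V) : Prop :=
  x ∈ LinearMap.range (TensorAlgebra.ι k : V →ₗ[k] TensorAlgebra k V) ^ n

/-- `I` is generated, as a two-sided ideal, by homogeneous elements of tensor degree `≥ 2`. -/
def IsGeneratedInDegreeGeTwo (I : TwoSidedIdeal (TensorAlgebra k V)) : Prop :=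
  ∃ R : Set (TensorAlgebra k V), (∀ r ∈ R, ∃ n, 2 ≤ n ∧ IsHomogeneous n r) ∧
    I = TwoSidedIdeal.span R

variable [Finite G] (M : YDModule k G V)

/-- Hopf ideals of the Hopf algebra `T(V)` in the category of Yetter-Drinfeld modules. -/
structure IsHopfIdeal (I : TwoSidedIdeal (TensorAlgebra k V)) : Prop where
  isSub : M.tensor.IsSub (toSub I)
  comul_mem : ∀ x ∈ I, M.comul x ∈
    Submodule.map₂ (TensorProduct.mk k (TensorAlgebra k V) (TensorAlgebra k V)) (toSub I) ⊤ ⊔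
    Submodule.map₂ (TensorProduct.mk k (TensorAlgebra k V) (TensorAlgebra k V)) ⊤ (toSub I)
  counit_eq_zero : ∀ x ∈ I, TensorAlgebra.algebraMapInv x = (0 : k)
  antipode_mem : ∀ x ∈ I, M.antipode x ∈ I

/-- The defining ideal `J(V)` of the Nichols algebra of `V`: the largest Hopf ideal of `T(V)`
generated as an ideal by homogeneous elements of degree `≥ 2`; see `isGreatest_nicholsIdeal`. -/
def nicholsIdeal : TwoSidedIdeal (TensorAlgebra k V) :=
  sSup {I | M.IsHopfIdeal I ∧ IsGeneratedInDegreeGeTwo I}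

theorem toSub_sSup (S : Set (TwoSidedIdeal (TensorAlgebra k V))) :
    toSub (sSup S) = ⨆ I ∈ S, toSub I := by
  let W : Submodule k (TensorAlgebra k V) := ⨆ I ∈ S, toSub I
  have hl : ∀ x : TensorAlgebra k V, W ≤ W.comap (LinearMap.mulLeft k x) := by
    intro x
    refine iSup₂_le fun I hI y hy => ?_
    exact Submodule.mem_iSup_of_mem I (Submodule.mem_iSup_of_mem hI (I.mul_mem_left x y hy))
  have hr : ∀ x : TensorAlgebra k V, W ≤ W.comap (LinearMap.mulRight k x) := by
    intro x
    refine iSup₂_le fun I hI y hy => ?_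
    exact Submodule.mem_iSup_of_mem I (Submodule.mem_iSup_of_mem hI (I.mul_mem_right y x hy))
  let K : TwoSidedIdeal (TensorAlgebra k V) := TwoSidedIdeal.mk' (W : Set _) W.zero_mem
    (fun h1 h2 => W.add_mem h1 h2) (fun h => W.neg_mem h) (fun {x _} h => hl x h)
    (fun {_ y} h => hr y h)
  have hK : ∀ x, x ∈ K ↔ x ∈ W := fun x => TwoSidedIdeal.mem_mk' _ _ _ _ _ _ x
  apply le_antisymm
  · have h1 : sSup S ≤ K := sSup_le fun I hI x hx => (hK x).2
      (Submodule.mem_iSup_of_mem I (Submodule.mem_iSup_of_mem hI hx))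
    intro x hx
    exact (hK x).1 (h1 hx)
  · exact iSup₂_le fun I hI x hx => (le_sSup hI : I ≤ sSup S) hx

theorem isGreatest_nicholsIdeal :
    IsGreatest {I | M.IsHopfIdeal I ∧ IsGeneratedInDegreeGeTwo I} M.nicholsIdeal := by
  have hle : ∀ I, M.IsHopfIdeal I → IsGeneratedInDegreeGeTwo I → I ≤ M.nicholsIdeal :=
    fun I h1 h2 => le_sSup ⟨h1, h2⟩
  have hsub : ∀ I, M.IsHopfIdeal I → IsGeneratedInDegreeGeTwo I → toSub I ≤ toSub M.nicholsIdeal :=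
    fun I h1 h2 x hx => hle I h1 h2 hx
  have key : ∀ W : Submodule k (TensorAlgebra k V),
      (∀ I, M.IsHopfIdeal I → IsGeneratedInDegreeGeTwo I → toSub I ≤ W) →
      ∀ x ∈ M.nicholsIdeal, x ∈ W := by
    intro W hW x hx
    have hx' : x ∈ toSub M.nicholsIdeal := hx
    rw [nicholsIdeal, toSub_sSup] at hx'
    exact (iSup₂_le fun I hI => hW I hI.1 hI.2 : _ ≤ W) hx'
  refine ⟨⟨⟨⟨fun h => ?_, ?_⟩, ?_, ?_, ?_⟩, ?_⟩, fun I hI => hle I hI.1 hI.2⟩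
  · exact key ((toSub M.nicholsIdeal).comap (M.tensor.act h)) fun I h1 h2 x hx =>
      hsub I h1 h2 (h1.isSub.act_mem h x hx)
  · exact key ((Submodule.map₂ (TensorProduct.mk k (MonoidAlgebra k G) (TensorAlgebra k V)) ⊤
      (toSub M.nicholsIdeal)).comap M.tensor.coact) fun I h1 h2 x hx =>
        Submodule.map₂_le_map₂_right (hsub I h1 h2) (h1.isSub.coact_mem x hx)
  · intro x hx
    refine key (Submodule.comap M.comul
      (Submodule.map₂ (TensorProduct.mk k (TensorAlgebra k V) (TensorAlgebra k V))
        (toSub M.nicholsIdeal) ⊤ ⊔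
      Submodule.map₂ (TensorProduct.mk k (TensorAlgebra k V) (TensorAlgebra k V)) ⊤
        (toSub M.nicholsIdeal))) (fun I h1 h2 y hy => ?_) x hx
    have h3 := sup_le_sup
      (Submodule.map₂_le_map₂_left (f := TensorProduct.mk k (TensorAlgebra k V) (TensorAlgebra k V))
        (q := ⊤) (hsub I h1 h2))
      (Submodule.map₂_le_map₂_right
        (f := TensorProduct.mk k (TensorAlgebra k V) (TensorAlgebra k V)) (p := ⊤) (hsub I h1 h2))
    exact h3 (h1.comul_mem y hy)
  · exact key (LinearMap.ker TensorAlgebra.algebraMapInv.toLinearMap) fun I h1 h2 x hx =>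
      h1.counit_eq_zero x hx
  · exact key ((toSub M.nicholsIdeal).comap M.antipode) fun I h1 h2 x hx =>
      hsub I h1 h2 (h1.antipode_mem x hx)
  · refine ⟨{r | r ∈ M.nicholsIdeal ∧ ∃ n, 2 ≤ n ∧ IsHomogeneous n r}, fun r hr => hr.2, ?_⟩
    apply le_antisymm
    · refine sSup_le ?_
      rintro I ⟨h1, h2⟩
      obtain ⟨R, hR, hIR⟩ := id h2
      rw [hIR, TwoSidedIdeal.span_le]
      intro r hr
      refine TwoSidedIdeal.subset_span ⟨hle I h1 h2 ?_, hR r hr⟩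
      rw [hIR]; exact TwoSidedIdeal.subset_span hr
    · rw [TwoSidedIdeal.span_le]
      exact fun r hr => hr.1

/-- The ideal of `T(V)` generated by `S` in the category of Yetter-Drinfeld modules: the smallest
two-sided ideal containing `S` which is a Yetter-Drinfeld submodule. -/
def ydSpan (S : Set (TensorAlgebra k V)) : TwoSidedIdeal (TensorAlgebra k V) :=
  sInf {I | M.tensor.IsSub (toSub I) ∧ S ⊆ I}

end NicholsIdeal

end YDModule

section RackRealizations

/-- Rack `2`-cocycles: `q_{i, j ▷ l} q_{j, l} = q_{i ▷ j, i ▷ l} q_{i, l}`. -/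
def IsTwoCocycle {k X : Type*} [Field k] [Rack X] (q : X → X → kˣ) : Prop :=
  ∀ i j l : X, q i (j ◃ l) * q j l = q (i ◃ j) (i ◃ l) * q i l

/-- A (faithful) principal YD-realization of `(X, q)` over `G`. -/
structure PrincipalRealization {k X : Type*} [Field k] [Rack X] (G : Type*) [Group G]
    (q : X → X → kˣ) where
  act : G →* Equiv.Perm X
  g : X → G
  χ : X → G → kˣ
  g_act : ∀ (h : G) (i : X), g (act h i) = h * g i * h⁻¹
  act_g : ∀ i j : X, act (g i) j = i ◃ j
  χ_mul : ∀ (i : X) (h t : G), χ i (h * t) = χ (act t i) h * χ i t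
  χ_g : ∀ i j : X, χ i (g j) = q j i
  injective_g : Function.Injective g

/-- The cocycle `q^*` on the dual rack `X^*`, which is `Xᵐᵒᵖ` with `i ▷* j = i ▷⁻¹ j`. -/
def qStar {k X : Type*} [Field k] [Rack X] (q : X → X → kˣ) : Xᵐᵒᵖ → Xᵐᵒᵖ → kˣ :=
  fun i j => q i.unop (i.unop ◃⁻¹ j.unop)

/-- The cocycle `q^{-*} = (q^*)⁻¹` on the dual rack. -/
def qNegStar {k X : Type*} [Field k] [Rack X] (q : X → X → kˣ) : Xᵐᵒᵖ → Xᵐᵒᵖ → kˣ :=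
  fun i j => (qStar q i j)⁻¹

variable {k X G : Type*} [Field k] [Rack X] [Group G] {q : X → X → kˣ}

theorem IsTwoCocycle.qStar (hq : IsTwoCocycle q) : IsTwoCocycle (qStar q) := by
  intro i j l
  induction i using MulOpposite.rec' with | _ i
  induction j using MulOpposite.rec' with | _ j
  induction l using MulOpposite.rec' with | _ l
  simp only [Rack.op_act_op_eq, NicholsRack.qStar, MulOpposite.unop_op]
  have h := hq i (i ◃⁻¹ j) (i ◃⁻¹ (j ◃⁻¹ l))
  have hc : i ◃⁻¹ (j ◃⁻¹ l) = (i ◃⁻¹ j) ◃⁻¹ (i ◃⁻¹ l) := Rack.self_distrib_inv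
  have hc' : (i ◃⁻¹ j) ◃ (i ◃⁻¹ (j ◃⁻¹ l)) = i ◃⁻¹ l := by rw [hc, Rack.act_invAct_eq]
  rw [hc', Rack.act_invAct_eq, Rack.act_invAct_eq] at h
  rw [← hc, mul_comm, ← h, mul_comm]

theorem IsTwoCocycle.qNegStar (hq : IsTwoCocycle q) : IsTwoCocycle (qNegStar q) := by
  intro i j l
  have h := hq.qStar i j l
  simp only [NicholsRack.qNegStar, ← mul_inv, h]

namespace PrincipalRealization

variable (R : PrincipalRealization G q)

theorem χ_one (i : X) : R.χ i 1 = 1 := by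
  have h := R.χ_mul i 1 1
  rw [map_one, Equiv.Perm.one_apply, mul_one] at h
  exact (left_eq_mul.1 h)

/-- The realization `(·, g⁻¹, χ)` of `(X^*, q^{-*})`. -/
def dual : PrincipalRealization G (qNegStar q) where
  act := (MulOpposite.opEquiv.permCongrHom : Equiv.Perm X ≃* Equiv.Perm Xᵐᵒᵖ).toMonoidHom.comp R.act
  g i := (R.g i.unop)⁻¹
  χ i := R.χ i.unop
  g_act h i := by
    simp [R.g_act, mul_assoc]
  act_g i j := by
    induction i using MulOpposite.rec' with | _ i
    induction j using MulOpposite.rec' with | _ j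
    rw [Rack.op_act_op_eq]
    have : (R.act (R.g i))⁻¹ j = i ◃⁻¹ j := by
      rw [Equiv.Perm.inv_eq_iff_eq, R.act_g, Rack.act_invAct_eq]
    simp [this]
  χ_mul i h t := by
    simp [R.χ_mul]
  χ_g i j := by
    induction i using MulOpposite.rec' with | _ i
    induction j using MulOpposite.rec' with | _ j
    have h := R.χ_mul i (R.g j) (R.g j)⁻¹
    have h2 : (R.act (R.g j))⁻¹ i = j ◃⁻¹ i := by
      rw [Equiv.Perm.inv_eq_iff_eq, R.act_g, Rack.act_invAct_eq]
    rw [mul_inv_cancel, R.χ_one, R.χ_g, map_inv, h2] at h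
    exact (inv_eq_of_mul_eq_one_right h.symm).symm
  injective_g i j h := MulOpposite.unop_injective (R.injective_g (inv_injective h))

/-- The Yetter-Drinfeld module `V(X, q)` with basis `x_i`, action `t · x_i = χ_i(t) x_{t · i}` and
coaction `x_i ↦ g_i ⊗ x_i`. -/
def toYD : YDModule k G (X →₀ k) where
  act :=
    { toFun := fun t => Finsupp.linearCombination k
        fun i => Finsupp.single (R.act t i) ((R.χ i t : kˣ) : k)
      map_one' := by
        ext i j; simp [R.χ_one]
      map_mul' := fun a b => by
        ext i j; simp [R.χ_mul, mul_comm] }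
  coact := Finsupp.linearCombination k
    fun i => MonoidAlgebra.single (R.g i) (1 : k) ⊗ₜ[k] Finsupp.single i (1 : k)
  coassoc := by
    ext i : 2; simp
  counit := by
    ext i : 2; simp
  compat := fun h => by
    ext i : 2; simp [R.g_act, ← TensorProduct.tmul_smul]

/-- The basis element `x_i` of `V(X, q)`, as an element of `T(X, q)`. -/
def x (_R : PrincipalRealization G q) (i : X) : TensorAlgebra k (X →₀ k) :=
  TensorAlgebra.ι k (Finsupp.single i 1)

variable [Finite G]

/-- The ideal `J(X, q)` of `T(X, q)`. -/
abbrev J : TwoSidedIdeal (TensorAlgebra k (X →₀ k)) := R.toYD.nicholsIdeal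

/-- The linear map `c : T(X, q) → T(X^*, q^{-*})` with `c(1) = 1`, `c(x_i) = y_i` and
`c(m r) = c(m₍₀₎) (m₍₋₁₎ · c(r))`, computed from `c(x_i r) = y_i (g_i · c(r))` and `c(1) = 1`;
see `frakC_one`, `frakC_x`, `frakC_mul`, `frakC_unique`. -/
def frakC : TensorAlgebra k (X →₀ k) →ₗ[k] TensorAlgebra k (Xᵐᵒᵖ →₀ k) :=
  LinearMap.applyₗ 1 ∘ₗ
    (TensorAlgebra.lift k (A := Module.End k (TensorAlgebra k (Xᵐᵒᵖ →₀ k)))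
      (Finsupp.linearCombination k fun i =>
        LinearMap.mulLeft k (R.dual.x (MulOpposite.op i)) *
          R.dual.toYD.tensor.act (R.g i))).toLinearMap

/-- The expression `c(m₍₀₎) (m₍₋₁₎ · b)`, for a linear map `c : T(X, q) → T(X^*, q^{-*})`. -/
def twistedMul (c : TensorAlgebra k (X →₀ k) →ₗ[k] TensorAlgebra k (Xᵐᵒᵖ →₀ k))
    (m : TensorAlgebra k (X →₀ k)) (b : TensorAlgebra k (Xᵐᵒᵖ →₀ k)) :
    TensorAlgebra k (Xᵐᵒᵖ →₀ k) :=
  LinearMap.mul' k _ (TensorProduct.map c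
    (LinearMap.applyₗ b ∘ₗ R.dual.toYD.tensor.act.asAlgebraHom.toLinearMap)
    (TensorProduct.comm k _ _ (R.toYD.tensor.coact m)))

theorem twistedMul_of_isDeg (c : TensorAlgebra k (X →₀ k) →ₗ[k] TensorAlgebra k (Xᵐᵒᵖ →₀ k))
    {g : G} {m : TensorAlgebra k (X →₀ k)} (hm : R.toYD.tensor.IsDeg g m)
    (b : TensorAlgebra k (Xᵐᵒᵖ →₀ k)) :
    R.twistedMul c m b = c m * R.dual.toYD.tensorAct g b := by
  unfold YDModule.IsDeg at hm
  simp [twistedMul, hm]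

theorem frakC_one : R.frakC 1 = 1 := by simp [frakC]

theorem frakC_x_mul (i : X) (r : TensorAlgebra k (X →₀ k)) : R.frakC (R.x i * r) =
    R.dual.x (MulOpposite.op i) * R.dual.toYD.tensorAct (R.g i) (R.frakC r) := by
  simp [frakC, x]

theorem frakC_x (i : X) : R.frakC (R.x i) = R.dual.x (MulOpposite.op i) := by
  simpa [frakC_one] using R.frakC_x_mul i 1

theorem isDeg_x (i : X) : R.toYD.tensor.IsDeg (R.g i) (R.x i) := by
  apply YDModule.IsDeg.tensor_ι
  simp [YDModule.IsDeg, toYD]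

theorem x_induction {P : TensorAlgebra k (X →₀ k) → Prop} (hone : P 1)
    (hmul : ∀ i g t, R.toYD.tensor.IsDeg g t → P t → P (R.x i * t))
    (hadd : ∀ a b, P a → P b → P (a + b))
    (hsmul : ∀ (r : k) a, P a → P (r • a)) (t : TensorAlgebra k (X →₀ k)) : P t := by
  induction t using R.toYD.tensorCoact_induction with
  | hone => exact hone
  | hmul g v h t hv ht hP hvt =>
    clear hv hvt
    have hzero : P 0 := by simpa using hsmul 0 1 hone
    induction v using Finsupp.induction_linear with
    | zero => simpa using hzero
    | add a b ha hb => rw [map_add, add_mul]; exact hadd _ _ ha hb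
    | single i r =>
      have : TensorAlgebra.ι k (Finsupp.single i r) * t = r • (R.x i * t) := by
        rw [x, ← smul_mul_assoc, ← map_smul, Finsupp.smul_single, smul_eq_mul, mul_one]
      rw [this]
      exact hsmul r _ (hmul i h t ht hP)
  | hadd a b ha hb => exact hadd a b ha hb
  | hsmul r a ha => exact hsmul r a ha

theorem twistedMul_add (c : TensorAlgebra k (X →₀ k) →ₗ[k] TensorAlgebra k (Xᵐᵒᵖ →₀ k))
    (m m' : TensorAlgebra k (X →₀ k)) (b : TensorAlgebra k (Xᵐᵒᵖ →₀ k)) :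
    R.twistedMul c (m + m') b = R.twistedMul c m b + R.twistedMul c m' b := by
  simp only [twistedMul, map_add]

theorem twistedMul_smul (c : TensorAlgebra k (X →₀ k) →ₗ[k] TensorAlgebra k (Xᵐᵒᵖ →₀ k))
    (a : k) (m : TensorAlgebra k (X →₀ k)) (b : TensorAlgebra k (Xᵐᵒᵖ →₀ k)) :
    R.twistedMul c (a • m) b = a • R.twistedMul c m b := by
  simp only [twistedMul, map_smul]

/-- The defining property `c(m r) = c(m₍₀₎) (m₍₋₁₎ · c(r))`, for all `m`, `r`. -/
theorem frakC_mul (m r : TensorAlgebra k (X →₀ k)) :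
    R.frakC (m * r) = R.twistedMul R.frakC m (R.frakC r) := by
  induction m using R.x_induction with
  | hone =>
    rw [R.twistedMul_of_isDeg _ YDModule.tensor_isDeg_one, frakC_one, one_mul, one_mul]
    have : R.dual.toYD.tensorAct 1 = AlgHom.id k _ := by ext v; simp
    simp [this]
  | hmul i g t ht hP =>
    rw [R.twistedMul_of_isDeg _ ht] at hP
    rw [R.twistedMul_of_isDeg _ ((R.isDeg_x i).tensor_mul ht), mul_assoc, frakC_x_mul, frakC_x_mul,
      hP]
    have : R.dual.toYD.tensorAct (R.g i * g) =
        (R.dual.toYD.tensorAct (R.g i)).comp (R.dual.toYD.tensorAct g) := by ext v; simp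
    simp [this, mul_assoc]
  | hadd a b ha hb => rw [add_mul, map_add, ha, hb, twistedMul_add]
  | hsmul a m hm => rw [smul_mul_assoc, map_smul, hm, twistedMul_smul]

theorem frakC_unique (c : TensorAlgebra k (X →₀ k) →ₗ[k] TensorAlgebra k (Xᵐᵒᵖ →₀ k))
    (hone : c 1 = 1) (hx : ∀ i, c (R.x i) = R.dual.x (MulOpposite.op i))
    (hmul : ∀ m r, c (m * r) = R.twistedMul c m (c r)) : c = R.frakC := by
  ext t
  induction t using R.x_induction with
  | hone => rw [hone, frakC_one]
  | hmul i g t _ hP =>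
    rw [hmul, R.twistedMul_of_isDeg _ (R.isDeg_x i), hx, hP, frakC_x_mul]
  | hadd a b ha hb => rw [map_add, map_add, ha, hb]
  | hsmul a m hm => rw [map_smul, map_smul, hm]

end PrincipalRealization

end RackRealizations

end

end NicholsRack

/-! The map `frakC` depends only on an equivariant linear isomorphism `e : V ≃ W` of Yetter-Drinfeld
modules that sends degree `g` to degree `g⁻¹`; here it relabels `x_i` as `y_i`. For such `e`, the
twist `c : T(V) → T(W)` preserves tensor degrees, commutes with `G` and inverts `G`-degrees. The
same construction for `e.symm` gives its inverse (`twist_twist`).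

The map `c` is not multiplicative, but `c(st) = c(s) (g · c(t))` when `s` has degree `g`
(`twist_mul`), so it sends ideals that are Yetter-Drinfeld submodules to ideals of the same kind
(`twistIdeal`). It reverses the coproduct (`comul_twist`), since the braiding of `W` acts by `g⁻¹`
and cancels the twist by `g`. It also satisfies `S c S = c` (`antipode_twist_antipode`). A Hopf
ideal `I` only comes with `S(I) ⊆ I`, whereas stability of `c(I)` under the antipode needs `S(I) =
I`. This follows by counting dimensions in each tensor degree (`exists_antipode_eq`), because `X`
embeds in the finite group `G`. By maximality `c(J) ⊆ J*`, and the inverse twist gives equality.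

For generators, the obstacle is that `c(a s b)` involves the `G`-components and translates of `s`,
which need not lie in the span of `S`. Nothing is needed when that span is a Yetter-Drinfeld
submodule (`twist_mul_mem`). When `S` is homogeneous, the components and translates lie in `J` in
the same tensor degree as `s`, and induction on the tensor degree applies. For generation in the
Yetter-Drinfeld category, ideals are pulled back along `c`. -/

namespace NicholsRack

noncomputable section

namespace YDModule

variable {k G V W : Type*} [Field k] [Group G] [AddCommGroup V] [Module k V]
  [AddCommGroup W] [Module k W]

/-! ### Projections onto `G`-degrees, and Yetter-Drinfeld submodules as graded `G`-stable subspaces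
-/

section Degree

/-- The projection onto the component of degree `g`. -/
def degProj (M : YDModule k G V) (g : G) : V →ₗ[k] V :=
  (TensorProduct.lid k V).toLinearMap ∘ₗ
    (Finsupp.lapply g ∘ₗ (MonoidAlgebra.coeffLinearEquiv k).toLinearMap :
      MonoidAlgebra k G →ₗ[k] k).rTensor V ∘ₗ M.coact

variable (M : YDModule k G V)

theorem isDeg_zero (g : G) : M.IsDeg g 0 := by simp [IsDeg]

variable {M}

theorem IsDeg.add {g : G} {v w : V} (hv : M.IsDeg g v) (hw : M.IsDeg g w) :
    M.IsDeg g (v + w) := by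
  unfold IsDeg at *
  rw [map_add, hv, hw, TensorProduct.tmul_add]

theorem IsDeg.smul {g : G} {v : V} (hv : M.IsDeg g v) (r : k) : M.IsDeg g (r • v) := by
  unfold IsDeg at *
  rw [map_smul, hv, TensorProduct.tmul_smul]

theorem IsDeg.degProj_self {g : G} {v : V} (hv : M.IsDeg g v) : M.degProj g v = v := by
  unfold IsDeg at hv
  simp [degProj, hv]

theorem IsDeg.degProj_of_ne {g h : G} {v : V} (hv : M.IsDeg g v) (hgh : g ≠ h) :
    M.degProj h v = 0 := by
  unfold IsDeg at hv
  simp [degProj, hv, hgh]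

theorem degProj_mem_of_le_span {U : Submodule k V}
    (hU : U ≤ Submodule.span k {u | u ∈ U ∧ ∃ g, M.IsDeg g u}) (g : G) {u : V} (hu : u ∈ U) :
    M.degProj g u ∈ U := by
  refine (Submodule.span_le (p := U.comap (M.degProj g))).2 ?_ (hU hu)
  rintro v ⟨hv, h, hd⟩
  change M.degProj g v ∈ U
  by_cases hh : h = g
  · subst hh; rwa [hd.degProj_self]
  · rw [hd.degProj_of_ne hh]; exact U.zero_mem

/-- The projection is the coaction followed by the coefficient functional at `g`, which maps `kG ⊗
U` into `U`. -/
theorem IsSub.degProj_mem {U : Submodule k V} (hU : M.IsSub U) (g : G) {u : V} (hu : u ∈ U) :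
    M.degProj g u ∈ U := by
  have h : Submodule.map₂ (TensorProduct.mk k (MonoidAlgebra k G) V) ⊤ U ≤
      U.comap ((TensorProduct.lid k V).toLinearMap ∘ₗ
        (Finsupp.lapply g ∘ₗ (MonoidAlgebra.coeffLinearEquiv k).toLinearMap :
          MonoidAlgebra k G →ₗ[k] k).rTensor V) := by
    rw [Submodule.map₂_le]
    intro a _ w hw
    exact U.smul_mem _ hw
  exact h (hU.coact_mem u hu)

variable [Finite G] (M)

theorem isDeg_degProj (g : G) (v : V) : M.IsDeg g (M.degProj g v) := by
  induction v using M.isDeg_induction with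
  | hdeg h v hv =>
    by_cases hh : h = g
    · subst hh; rwa [hv.degProj_self]
    · rw [hv.degProj_of_ne hh]; exact M.isDeg_zero g
  | hzero => rw [map_zero]; exact M.isDeg_zero g
  | hadd a b ha hb => rw [map_add]; exact ha.add hb
  | hsmul r a ha => rw [map_smul]; exact ha.smul r

theorem sum_degProj [Fintype G] (v : V) : ∑ g, M.degProj g v = v := by
  classical
  induction v using M.isDeg_induction with
  | hdeg h v hv =>
    rw [Finset.sum_eq_single h (fun g _ hg => hv.degProj_of_ne hg.symm) (by simp), hv.degProj_self]
  | hzero => simp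
  | hadd a b ha hb => simp only [map_add, Finset.sum_add_distrib, ha, hb]
  | hsmul r a ha => simp only [map_smul, ← Finset.smul_sum, ha]

variable {M}

/-- To prove a linear statement for the elements of a subspace stable under the projections onto
the components, it is enough to treat its elements having a degree. -/
theorem le_of_isDeg {U U' : Submodule k V} (hU : ∀ g, ∀ u ∈ U, M.degProj g u ∈ U)
    (h : ∀ g, ∀ u ∈ U, M.IsDeg g u → u ∈ U') : U ≤ U' := by
  cases nonempty_fintype G
  intro u hu
  rw [← M.sum_degProj u]
  exact Submodule.sum_mem _ fun g _ => h g _ (hU g u hu) (M.isDeg_degProj g u)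

/-- Converse of `IsSub.degProj_mem`: a subspace closed under all projections is the sum of its
pieces `U_g`, and the coaction sends `u` in `U_g` to `g ⊗ u`. Testing stability on projections makes
intersections and images easy to treat. -/
theorem IsSub.of_degProj_mem {U : Submodule k V} (hact : ∀ h : G, ∀ u ∈ U, M.act h u ∈ U)
    (hU : ∀ g, ∀ u ∈ U, M.degProj g u ∈ U) : M.IsSub U where
  act_mem := hact
  coact_mem _ hw := le_of_isDeg (U' := Submodule.comap M.coact
      (Submodule.map₂ (TensorProduct.mk k (MonoidAlgebra k G) V) ⊤ U)) hU (fun g u hu hd => by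
    unfold IsDeg at hd
    rw [Submodule.mem_comap, hd]
    exact Submodule.apply_mem_map₂ _ Submodule.mem_top hu) hw

theorem IsSub.inf {U U' : Submodule k V} (hU : M.IsSub U) (hU' : M.IsSub U') :
    M.IsSub (U ⊓ U') :=
  .of_degProj_mem (fun h u hu => ⟨hU.act_mem h u hu.1, hU'.act_mem h u hu.2⟩)
    fun g _ hu => ⟨hU.degProj_mem g hu.1, hU'.degProj_mem g hu.2⟩

/-- An element of `T(V)` of degree `g` is a combination of monomials of degree `g`. -/
theorem IsDeg.tensor_induction {P : G → TensorAlgebra k V → Prop} (hone : P 1 1)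
    (hmul : ∀ g v h t, M.IsDeg g v → M.tensor.IsDeg h t → P h t →
      P (g * h) (TensorAlgebra.ι k v * t))
    (hzero : ∀ g, P g 0) (hadd : ∀ g a b, P g a → P g b → P g (a + b))
    (hsmul : ∀ g (r : k) a, P g a → P g (r • a)) {g : G} {t : TensorAlgebra k V}
    (ht : M.tensor.IsDeg g t) : P g t := by
  -- Expanding `t` into monomials does not respect its degree, so the claim is proved for all
  -- components of all elements; a monomial has at most one nonzero component.
  suffices H : ∀ t g, P g (M.tensor.degProj g t) by
    have := H t g
    rwa [ht.degProj_self] at this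
  clear ht t g
  intro t
  induction t using M.tensorCoact_induction with
  | hone =>
    intro g
    by_cases hg : 1 = g
    · subst hg; rwa [tensor_isDeg_one.degProj_self]
    · rw [tensor_isDeg_one.degProj_of_ne hg]; exact hzero g
  | hmul g v h t hv ht hP hvt =>
    intro g'
    have hd : M.tensor.IsDeg (g * h) (TensorAlgebra.ι k v * t) := hvt
    have ht' : M.tensor.IsDeg h t := ht
    by_cases hg : g * h = g'
    · subst hg
      rw [hd.degProj_self]
      have := hP h
      rw [ht'.degProj_self] at this
      exact hmul g v h t hv ht' this
    · rw [hd.degProj_of_ne hg]; exact hzero g'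
  | hadd a b ha hb => intro g; rw [map_add]; exact hadd _ _ _ (ha g) (hb g)
  | hsmul r a ha => intro g; rw [map_smul]; exact hsmul _ _ _ (ha g)

end Degree

/-! ### Tensor degree: compatibility with the action, the `G`-grading and the antipode -/

section TensorAct

variable (M : YDModule k G V)

theorem tensorAct_one_apply (t : TensorAlgebra k V) : M.tensorAct 1 t = t := by
  have : M.tensorAct 1 = AlgHom.id k _ := by ext v; simp
  rw [this]; rfl

theorem tensorAct_mul_apply (a b : G) (t : TensorAlgebra k V) :
    M.tensorAct (a * b) t = M.tensorAct a (M.tensorAct b t) := by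
  have : M.tensorAct (a * b) = (M.tensorAct a).comp (M.tensorAct b) := by ext v; simp
  rw [this]; rfl

@[simp]
theorem tensorAct_inv_apply_self (a : G) (t : TensorAlgebra k V) :
    M.tensorAct a⁻¹ (M.tensorAct a t) = t := by
  rw [← tensorAct_mul_apply, inv_mul_cancel, tensorAct_one_apply]

@[simp]
theorem tensorAct_apply_inv_self (a : G) (t : TensorAlgebra k V) :
    M.tensorAct a (M.tensorAct a⁻¹ t) = t := by
  rw [← tensorAct_mul_apply, mul_inv_cancel, tensorAct_one_apply]

variable {M}

theorem IsHomogeneous.tensorAct {n : ℕ} {t : TensorAlgebra k V} (ht : IsHomogeneous n t) (h : G) :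
    IsHomogeneous n (M.tensorAct h t) := by
  have h1 : (LinearMap.range (TensorAlgebra.ι k : V →ₗ[k] _)).map (M.tensorAct h).toLinearMap ≤
      LinearMap.range (TensorAlgebra.ι k : V →ₗ[k] _) := by
    rintro _ ⟨_, ⟨v, rfl⟩, rfl⟩
    exact ⟨M.act h v, (M.tensorAct_ι h v).symm⟩
  have h2 := Submodule.mem_map_of_mem (f := (M.tensorAct h).toLinearMap) ht
  rw [Submodule.map_pow] at h2
  exact pow_le_pow_left' h1 n h2

theorem isHomogeneous_one : IsHomogeneous (k := k) (V := V) 0 1 := by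
  unfold IsHomogeneous
  rw [pow_zero]; exact Submodule.one_le.1 le_rfl

theorem isHomogeneous_ι (v : V) : IsHomogeneous (k := k) 1 (TensorAlgebra.ι k v) := by
  unfold IsHomogeneous
  rw [pow_one]; exact ⟨v, rfl⟩

theorem IsHomogeneous.mul {m n : ℕ} {s t : TensorAlgebra k V} (hs : IsHomogeneous m s)
    (ht : IsHomogeneous n t) : IsHomogeneous (m + n) (s * t) := by
  unfold IsHomogeneous at *
  rw [pow_add]; exact Submodule.mul_mem_mul hs ht

theorem IsHomogeneous.ι_mul {n : ℕ} (v : V) {t : TensorAlgebra k V} (ht : IsHomogeneous n t) :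
    IsHomogeneous (n + 1) (TensorAlgebra.ι k v * t) := by
  rw [add_comm]; exact (isHomogeneous_ι v).mul ht

theorem IsHomogeneous.mul_ι {n : ℕ} (v : V) {t : TensorAlgebra k V} (ht : IsHomogeneous n t) :
    IsHomogeneous (n + 1) (t * TensorAlgebra.ι k v) := ht.mul (isHomogeneous_ι v)

theorem IsHomogeneous.zero {n : ℕ} : IsHomogeneous (k := k) (V := V) n 0 :=
  Submodule.zero_mem _

theorem IsHomogeneous.add {n : ℕ} {s t : TensorAlgebra k V} (hs : IsHomogeneous n s)
    (ht : IsHomogeneous n t) : IsHomogeneous n (s + t) := Submodule.add_mem _ hs ht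

theorem IsHomogeneous.smul {n : ℕ} {t : TensorAlgebra k V} (ht : IsHomogeneous n t) (r : k) :
    IsHomogeneous n (r • t) := Submodule.smul_mem _ r ht

theorem IsHomogeneous.neg {n : ℕ} {t : TensorAlgebra k V} (ht : IsHomogeneous n t) :
    IsHomogeneous n (-t) := Submodule.neg_mem _ ht

/-- Tensor-homogeneous elements are combinations of monomials `v t` with `v` and `t` having a
degree in `G`. -/
theorem range_ι_pow_le_span [Finite G] (M : YDModule k G V)
    {P : ℕ → TensorAlgebra k V → Prop} (hone : P 0 1)
    (hmul : ∀ n g v h t, M.IsDeg g v → M.tensor.IsDeg h t → IsHomogeneous n t → P n t →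
      P (n + 1) (TensorAlgebra.ι k v * t)) (n : ℕ) :
    LinearMap.range (TensorAlgebra.ι k : V →ₗ[k] TensorAlgebra k V) ^ n ≤
      Submodule.span k {t | IsHomogeneous n t ∧ (∃ g, M.tensor.IsDeg g t) ∧ P n t} := by
  induction n with
  | zero =>
    rw [pow_zero, Submodule.one_le]
    exact Submodule.subset_span ⟨isHomogeneous_one, ⟨1, tensor_isDeg_one⟩, hone⟩
  | succ n ih =>
    rw [pow_succ', Submodule.mul_le]
    rintro _ ⟨v, rfl⟩ t ht
    replace ht := ih ht
    induction v using M.isDeg_induction with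
    | hdeg g v hv =>
      induction ht using Submodule.span_induction with
      | mem t ht =>
        obtain ⟨h0, ⟨h, hh⟩, hP⟩ := ht
        exact Submodule.subset_span ⟨h0.ι_mul v, ⟨g * h, hv.tensor_ι.tensor_mul hh⟩,
          hmul n g v h t hv hh h0 hP⟩
      | zero => simp
      | add x y _ _ hx hy => rw [mul_add]; exact add_mem hx hy
      | smul r x _ hx => rw [mul_smul_comm]; exact Submodule.smul_mem _ _ hx
    | hzero => simp
    | hadd a b ha hb => rw [map_add, add_mul]; exact add_mem ha hb
    | hsmul r a ha => rw [map_smul, smul_mul_assoc]; exact Submodule.smul_mem _ _ ha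

theorem IsHomogeneous.induction [Finite G]
    {P : ℕ → TensorAlgebra k V → Prop} (hone : P 0 1)
    (hmul : ∀ n g v h t, M.IsDeg g v → M.tensor.IsDeg h t → IsHomogeneous n t → P n t →
      P (n + 1) (TensorAlgebra.ι k v * t))
    (hzero : ∀ n, P n 0) (hadd : ∀ n a b, P n a → P n b → P n (a + b))
    (hsmul : ∀ n (r : k) a, P n a → P n (r • a)) {n : ℕ} {t : TensorAlgebra k V}
    (ht : IsHomogeneous n t) : P n t := by
  replace ht := M.range_ι_pow_le_span hone hmul n ht
  induction ht using Submodule.span_induction with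
  | mem x hx => exact hx.2.2
  | zero => exact hzero n
  | add x y _ _ hx hy => exact hadd n x y hx hy
  | smul r x _ hx => exact hsmul n r x hx

variable (M) in
-- The two gradings of `T(V)` are compatible: `V^{⊗ n}` is spanned by monomials in vectors having a
-- `G`-degree.
theorem isSub_range_ι_pow [Finite G] (n : ℕ) : M.tensor.IsSub
    (LinearMap.range (TensorAlgebra.ι k : V →ₗ[k] TensorAlgebra k V) ^ n) :=
  .of_degProj_mem (fun h _ hu => IsHomogeneous.tensorAct (M := M) hu h) fun g _ hu =>
    degProj_mem_of_le_span ((M.range_ι_pow_le_span (P := fun _ _ => True) trivial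
      (fun _ _ _ _ _ _ _ _ _ => trivial) n).trans
        (Submodule.span_mono fun _ ht => ⟨ht.1, ht.2.1⟩)) g hu

theorem IsHomogeneous.antipode [Finite G] {n : ℕ} {t : TensorAlgebra k V}
    (ht : IsHomogeneous n t) : IsHomogeneous n (M.antipode t) := by
  refine IsHomogeneous.induction (M := M) (P := fun n t => IsHomogeneous n (M.antipode t))
    ?_ ?_ ?_ ?_ ?_ ht
  · rw [antipode_one]; exact isHomogeneous_one
  · intro n g v h t hv _ _ ht
    rw [antipode_ι_mul _ hv]
    exact ((ht.tensorAct g).mul_ι v).neg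
  · intro n; rw [map_zero]; exact .zero
  · intro n a b ha hb; rw [map_add]; exact ha.add hb
  · intro n r a ha; rw [map_smul]; exact ha.smul r

end TensorAct

/-! ### The twisting map attached to a degree-inverting isomorphism -/

/-- An equivariant isomorphism which inverts the degrees in `G`. -/
structure IsDegInverting (M : YDModule k G V) (N : YDModule k G W) (e : V ≃ₗ[k] W) : Prop where
  act : ∀ h v, e (M.act h v) = N.act h (e v)
  isDeg : ∀ g v, M.IsDeg g v → N.IsDeg g⁻¹ (e v)

section Twist

variable [Finite G] {M : YDModule k G V} {N : YDModule k G W} {e : V ≃ₗ[k] W}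

theorem degProj_apply_of_isDeg_inv {f : V →ₗ[k] W} (hf : ∀ g v, M.IsDeg g v → N.IsDeg g⁻¹ (f v))
    (g : G) (v : V) : N.degProj g (f v) = f (M.degProj g⁻¹ v) := by
  induction v using M.isDeg_induction with
  | hdeg h v hv =>
    by_cases hh : h⁻¹ = g
    · subst hh
      rw [inv_inv, (hf h v hv).degProj_self, hv.degProj_self]
    · rw [(hf h v hv).degProj_of_ne hh, hv.degProj_of_ne (fun h' => hh (by rw [h', inv_inv])),
        map_zero]
  | hzero => simp
  | hadd a b ha hb => simp only [map_add, ha, hb]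
  | hsmul r a ha => simp only [map_smul, ha]

/-- The definition only says that `e` carries degrees forward. Conversely, if `w` has degree `g`,
then `e.symm w` equals its own projection onto degree `g⁻¹`. -/
theorem IsDegInverting.symm (he : IsDegInverting M N e) : IsDegInverting N M e.symm where
  act h w := by rw [LinearEquiv.symm_apply_eq, he.act, LinearEquiv.apply_symm_apply]
  isDeg g w hw := by
    have h1 := degProj_apply_of_isDeg_inv (f := e.toLinearMap) he.isDeg g (e.symm w)
    rw [LinearEquiv.coe_coe, e.apply_symm_apply, hw.degProj_self] at h1
    rw [h1, e.symm_apply_apply]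
    exact M.isDeg_degProj _ _

variable (M N e) in
/-- The linear map `c : T(V) → T(W)` with `c(1) = 1` and `c(v t) = e(v₍₀₎) (v₍₋₁₎ · c(t))`. -/
def twist : TensorAlgebra k V →ₗ[k] TensorAlgebra k W :=
  LinearMap.applyₗ 1 ∘ₗ
    (TensorAlgebra.lift k (A := Module.End k (TensorAlgebra k W))
      (LinearMap.mul' k (Module.End k (TensorAlgebra k W)) ∘ₗ
        TensorProduct.map (LinearMap.mul k (TensorAlgebra k W) ∘ₗ TensorAlgebra.ι k ∘ₗ
          e.toLinearMap) N.tensor.act.asAlgebraHom.toLinearMap ∘ₗ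
        (TensorProduct.comm k (MonoidAlgebra k G) V).toLinearMap ∘ₗ M.coact)).toLinearMap

theorem twist_one : twist M N e 1 = 1 := by simp [twist]

theorem twist_ι_mul {g : G} {v : V} (hv : M.IsDeg g v) (t : TensorAlgebra k V) :
    twist M N e (TensorAlgebra.ι k v * t) =
      TensorAlgebra.ι k (e v) * N.tensorAct g (twist M N e t) := by
  unfold IsDeg at hv
  simp [twist, hv]

theorem IsHomogeneous.twist {n : ℕ} {t : TensorAlgebra k V} (ht : IsHomogeneous n t) :
    IsHomogeneous n (twist M N e t) := by
  refine IsHomogeneous.induction (M := M) (P := fun n t => IsHomogeneous n (YDModule.twist M N e t))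
    ?_ ?_ ?_ ?_ ?_ ht
  · rw [twist_one]; exact isHomogeneous_one
  · intro n g v h t hv _ _ ht
    rw [twist_ι_mul hv]
    exact (ht.tensorAct g).ι_mul _
  · intro n; rw [map_zero]; exact .zero
  · intro n a b ha hb; rw [map_add]; exact ha.add hb
  · intro n r a ha; rw [map_smul]; exact ha.smul r

/-- The recursion for one left factor `v` iterates, because `G` acts on `T(W)` by algebra maps and
the degree of a product is the product of the degrees. -/
theorem twist_mul {g : G} {s : TensorAlgebra k V} (hs : M.tensor.IsDeg g s)
    (t : TensorAlgebra k V) :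
    twist M N e (s * t) = twist M N e s * N.tensorAct g (twist M N e t) := by
  refine IsDeg.tensor_induction (M := M) (P := fun g s =>
      twist M N e (s * t) = twist M N e s * N.tensorAct g (twist M N e t))
    ?_ ?_ ?_ ?_ ?_ hs
  · rw [one_mul, twist_one, one_mul, tensorAct_one_apply]
  · intro g v h s hv _ hs
    rw [mul_assoc, twist_ι_mul hv, hs, twist_ι_mul hv, map_mul, tensorAct_mul_apply, mul_assoc]
  · intro g; simp
  · intro g a b ha hb; simp only [add_mul, map_add, ha, hb]
  · intro g r a ha; simp only [smul_mul_assoc, map_smul, ha]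

theorem algebraMapInv_twist (t : TensorAlgebra k V) :
    TensorAlgebra.algebraMapInv (twist M N e t) = TensorAlgebra.algebraMapInv (R := k) t := by
  induction t using M.tensorCoact_induction with
  | hone => simp [twist_one]
  | hmul g v h t hv _ ht _ =>
    rw [twist_ι_mul hv]
    simp [TensorAlgebra.algebraMapInv]
  | hadd a b ha hb => simp only [map_add, ha, hb]
  | hsmul r a ha => simp only [map_smul, ha]

namespace IsDegInverting

/-- If `v` has degree `g`, then `h · v` has degree `h g h⁻¹`, and `(h g h⁻¹) h = h g`. -/
theorem twist_act (he : IsDegInverting M N e) (h : G) (t : TensorAlgebra k V) :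
    twist M N e (M.tensorAct h t) = N.tensorAct h (twist M N e t) := by
  induction t using M.tensorCoact_induction with
  | hone => simp [twist_one]
  | hmul g v h' t hv _ ht _ =>
    rw [map_mul, tensorAct_ι, twist_ι_mul (hv.act h), ht, twist_ι_mul hv, map_mul, tensorAct_ι,
      he.act, ← tensorAct_mul_apply, ← tensorAct_mul_apply, inv_mul_cancel_right]
  | hadd a b ha hb => simp only [map_add, ha, hb]
  | hsmul r a ha => simp only [map_smul, ha]

/-- For `v` of degree `g` and `t` of degree `h`, the degree of `e(v) (g · c(t))` is `g⁻¹ (g h⁻¹ g⁻¹)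
= (g h)⁻¹`. -/
theorem isDeg_twist (he : IsDegInverting M N e) {g : G} {t : TensorAlgebra k V}
    (ht : M.tensor.IsDeg g t) : N.tensor.IsDeg g⁻¹ (twist M N e t) := by
  refine IsDeg.tensor_induction (M := M) (P := fun g t => N.tensor.IsDeg g⁻¹ (twist M N e t))
    ?_ ?_ ?_ ?_ ?_ ht
  · rw [twist_one, inv_one]; exact tensor_isDeg_one
  · intro g v h t hv _ ht
    rw [twist_ι_mul hv]
    have := (he.isDeg g v hv).tensor_ι.tensor_mul (ht.act g)
    rwa [mul_assoc, inv_mul_cancel_left, ← mul_inv_rev] at this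
  · intro g; rw [map_zero]; exact isDeg_zero _ _
  · intro g a b ha hb; rw [map_add]; exact ha.add hb
  · intro g r a ha; rw [map_smul]; exact ha.smul r

/-- The first twist acts on the tail by `g`; the second sees `e(v)`, of degree `g⁻¹`, and undoes
this. -/
theorem twist_twist (he : IsDegInverting M N e) (t : TensorAlgebra k V) :
    twist N M e.symm (twist M N e t) = t := by
  induction t using M.tensorCoact_induction with
  | hone => rw [twist_one, twist_one]
  | hmul g v h t hv _ ht _ =>
    rw [twist_ι_mul hv, twist_ι_mul (he.isDeg g v hv), he.symm.twist_act, ht,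
      tensorAct_inv_apply_self, e.symm_apply_apply]
  | hadd a b ha hb => simp only [map_add, ha, hb]
  | hsmul r a ha => simp only [map_smul, ha]

theorem twist_twist_symm (he : IsDegInverting M N e) (t : TensorAlgebra k W) :
    twist M N e (twist N M e.symm t) = t := he.symm.twist_twist t

theorem twist_injective (he : IsDegInverting M N e) : Function.Injective (twist M N e) :=
  Function.LeftInverse.injective he.twist_twist

/-- `c` is an anti-morphism of coalgebras. -/
theorem comul_twist (he : IsDegInverting M N e) (t : TensorAlgebra k V) :
    N.comul (twist M N e t) =
      TensorProduct.map (twist M N e) (twist M N e) (TensorProduct.comm k _ _ (M.comul t)) := by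
  -- The coproduct of `T(W)` is equivariant; this is needed since `c(v t)` contains `g · c(t)`.
  have hact : ∀ g (t : TensorAlgebra k W), N.comul (N.tensorAct g t) =
      TensorProduct.map (N.tensorAct g).toLinearMap (N.tensorAct g).toLinearMap (N.comul t) := by
    intro g t
    induction t using N.tensorCoact_induction with
    | hone => simp [comul_one]
    | hmul h w h' t hw _ ht _ =>
      rw [map_mul, tensorAct_ι, comul_ι_mul, comul_ι_mul, ht]
      induction N.comul t with
      | zero => simp
      | add a b ha hb => simp only [TensorProduct.tmul_add, map_add, ha, hb]
      | tmul a b =>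
        simp only [TensorProduct.add_tmul, map_add, sqMul_of_isDeg tensor_isDeg_one,
          sqMul_of_isDeg hw.tensor_ι, sqMul_of_isDeg (hw.act g).tensor_ι, TensorProduct.map_tmul,
          AlgHom.toLinearMap_apply, map_mul, tensorAct_ι, ← tensorAct_mul_apply, one_mul,
          mul_one, inv_mul_cancel_right]
    | hadd a b ha hb => simp only [map_add, ha, hb]
    | hsmul r a ha => simp only [map_smul, ha]
  induction t using M.tensorCoact_induction with
  | hone => simp [comul_one, twist_one]
  | hmul g v h t hv _ ht _ =>
    rw [twist_ι_mul hv, comul_ι_mul, hact, ht, comul_ι_mul]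
    induction M.comul t with
    | zero => simp
    | add a b ha hb => simp only [TensorProduct.tmul_add, map_add, ha, hb]
    | tmul a b =>
      -- Moving `e(v)`, of degree `g⁻¹`, past `g · c(b)` leaves `c(b)`. Both sides are then `e(v) (g
      -- · c(b)) ⊗ g · c(a)` plus `c(b) ⊗ e(v) (g · c(a))`, with the summands in opposite orders
      -- because of the flip.
      simp only [TensorProduct.add_tmul, map_add, sqMul_of_isDeg tensor_isDeg_one,
        sqMul_of_isDeg hv.tensor_ι, sqMul_of_isDeg (he.isDeg g v hv).tensor_ι,
        TensorProduct.map_tmul, TensorProduct.comm_tmul, AlgHom.toLinearMap_apply, one_mul,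
        tensorAct_inv_apply_self, tensorAct_one_apply, twist_ι_mul hv, he.twist_act]
      exact add_comm _ _
  | hadd a b ha hb => simp only [map_add, ha, hb]
  | hsmul r a ha => simp only [map_smul, ha]

/-- `c` intertwines the antipode of `T(W)` with the inverse of the antipode of `T(V)`. -/
theorem antipode_twist_antipode (he : IsDegInverting M N e) (t : TensorAlgebra k V) :
    N.antipode (twist M N e (M.antipode t)) = twist M N e t := by
  induction t using M.tensorCoact_induction with
  | hone => simp [antipode_one, twist_one]
  | hmul g v h t hv hh ht _ =>
    have h1 : M.tensor.IsDeg (g * h * g⁻¹) (M.tensorAct g (M.antipode t)) :=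
      (IsDeg.antipode (M := M) hh).act g
    have hv' := (he.isDeg g v hv).act (g * h * g⁻¹)
    have hι : twist M N e (TensorAlgebra.ι k v) = TensorAlgebra.ι k (e v) := by
      have := twist_ι_mul (N := N) (e := e) hv 1
      rwa [mul_one, twist_one, map_one, mul_one] at this
    rw [antipode_ι_mul _ hv, map_neg, map_neg, twist_mul h1, hι, antipode_mul,
      braid_of_isDeg _ _ (IsDeg.antipode (he.isDeg_twist h1)), tensorAct_ι, antipode_ι,
      he.twist_act, antipode_act, ht, twist_ι_mul hv]
    simp only [map_neg, tensor_act, tensorAct_ι, LinearMap.mul'_apply, TensorProduct.neg_tmul,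
      neg_neg]
    -- `twist_mul` acts on `e(v)` by `g h g⁻¹`. The braiding in `antipode_mul` acts by the degree of
    -- the twisted left factor, which is the inverse, so the two cancel.
    rw [← Module.End.mul_apply, ← map_mul, inv_mul_cancel, map_one, Module.End.one_apply]
  | hadd a b ha hb => simp only [map_add, ha, hb]
  | hsmul r a ha => simp only [map_smul, ha]

end IsDegInverting

end Twist

/-! ### Ideals generated by elements homogeneous for the tensor degree -/

section Homogeneous

/-- `U` need not be an ideal: it will be a preimage under `c`, which is not a ring homomorphism. -/
theorem toSub_span_le {S : Set (TensorAlgebra k V)} {U : Submodule k (TensorAlgebra k V)}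
    (h : ∀ a b, ∀ s ∈ S, a * s * b ∈ U) : toSub (TwoSidedIdeal.span S) ≤ U := by
  intro x hx
  rw [mem_toSub, TwoSidedIdeal.mem_span_iff_mem_addSubgroup_closure] at hx
  refine (AddSubgroup.closure_le (K := U.toAddSubgroup)).2 ?_ hx
  rintro _ ⟨_, ⟨a, _, s, hs, rfl⟩, b, _, rfl⟩
  exact h a b s hs

theorem span_isHomogeneous :
    Submodule.span k {x : TensorAlgebra k V | ∃ n, IsHomogeneous n x} = ⊤ := by
  rw [eq_top_iff, ← (DirectSum.Decomposition.isInternal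
    ((LinearMap.range (TensorAlgebra.ι k : V →ₗ[k] TensorAlgebra k V) ^ ·) :
      ℕ → Submodule k _)).submodule_iSup_eq_top]
  exact iSup_le fun n x hx => Submodule.subset_span ⟨n, hx⟩

/-- `x = a s b` with `s ∈ S` and `a`, `s`, `b` homogeneous of degrees with sum `n`. -/
def IsHomogeneousMultiple (S : Set (TensorAlgebra k V)) (n : ℕ) (x : TensorAlgebra k V) : Prop :=
  ∃ i j l a s b, IsHomogeneous i a ∧ IsHomogeneous j s ∧ IsHomogeneous l b ∧ s ∈ S ∧
    i + j + l = n ∧ x = a * s * b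

theorem IsHomogeneousMultiple.isHomogeneous {S : Set (TensorAlgebra k V)} {n : ℕ}
    {x : TensorAlgebra k V} (hx : IsHomogeneousMultiple S n x) : IsHomogeneous n x := by
  obtain ⟨i, j, l, a, s, b, ha, hs, hb, -, rfl, rfl⟩ := hx
  exact (ha.mul hs).mul hb

theorem toSub_span_le_span {S : Set (TensorAlgebra k V)} (hS : ∀ s ∈ S, ∃ n, IsHomogeneous n s) :
    toSub (TwoSidedIdeal.span S) ≤ Submodule.span k {x | ∃ n, IsHomogeneousMultiple S n x} := by
  refine toSub_span_le fun a b s hs => ?_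
  have ha : a ∈ Submodule.span k {x : TensorAlgebra k V | ∃ n, IsHomogeneous n x} := by
    rw [span_isHomogeneous]; trivial
  have hb : b ∈ Submodule.span k {x : TensorAlgebra k V | ∃ n, IsHomogeneous n x} := by
    rw [span_isHomogeneous]; trivial
  obtain ⟨j, hj⟩ := hS s hs
  induction ha using Submodule.span_induction with
  | mem a ha =>
    obtain ⟨i, hi⟩ := ha
    induction hb using Submodule.span_induction with
    | mem b hb =>
      obtain ⟨l, hl⟩ := hb
      exact Submodule.subset_span ⟨_, i, j, l, a, s, b, hi, hj, hl, hs, rfl, rfl⟩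
    | zero => simp
    | add x y _ _ hx hy => rw [mul_add]; exact add_mem hx hy
    | smul r x _ hx => rw [mul_smul_comm]; exact Submodule.smul_mem _ _ hx
  | zero => simp
  | add x y _ _ hx hy => rw [add_mul, add_mul]; exact add_mem hx hy
  | smul r x _ hx => rw [smul_mul_assoc, smul_mul_assoc]; exact Submodule.smul_mem _ _ hx

/-- Projection onto tensor degree `n` fixes `x`, keeps the homogeneous multiples of degree `n` and
kills the others. -/
theorem IsHomogeneous.mem_span_of_mem_span {S : Set (TensorAlgebra k V)}
    (hS : ∀ s ∈ S, ∃ n, IsHomogeneous n s) {n : ℕ} {x : TensorAlgebra k V}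
    (hn : IsHomogeneous n x) (hx : x ∈ TwoSidedIdeal.span S) :
    x ∈ Submodule.span k {x | IsHomogeneousMultiple S n x} := by
  let A : ℕ → Submodule k (TensorAlgebra k V) :=
    (LinearMap.range (TensorAlgebra.ι k : V →ₗ[k] TensorAlgebra k V) ^ ·)
  have h1 : Submodule.span k {x | ∃ n, IsHomogeneousMultiple S n x} ≤
      (Submodule.span k {x | IsHomogeneousMultiple S n x}).comap (GradedAlgebra.proj A n) := by
    rw [Submodule.span_le]
    rintro y ⟨m, hy⟩
    change (DirectSum.decompose A y n : TensorAlgebra k V) ∈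
      Submodule.span k {x | IsHomogeneousMultiple S n x}
    by_cases hmn : m = n
    · subst hmn
      rw [DirectSum.decompose_of_mem_same A hy.isHomogeneous]
      exact Submodule.subset_span hy
    · rw [DirectSum.decompose_of_mem_ne A hy.isHomogeneous hmn]
      exact Submodule.zero_mem _
  have h2 := h1 (toSub_span_le_span hS hx)
  change (DirectSum.decompose A x n : TensorAlgebra k V) ∈
    Submodule.span k {x | IsHomogeneousMultiple S n x} at h2
  rwa [DirectSum.decompose_of_mem_same A hn] at h2

theorem IsGeneratedInDegreeGeTwo.toSub_le_span {I : TwoSidedIdeal (TensorAlgebra k V)}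
    (hI : IsGeneratedInDegreeGeTwo I) :
    toSub I ≤ Submodule.span k {x | x ∈ I ∧ ∃ n, 2 ≤ n ∧ IsHomogeneous n x} := by
  obtain ⟨S, hS, rfl⟩ := hI
  refine (toSub_span_le_span fun s hs => (hS s hs).imp fun _ h => h.2).trans ?_
  refine Submodule.span_le.2 ?_
  rintro x ⟨n, i, j, l, a, s, b, ha, hj, hb, hs, hn, rfl⟩
  have hmem : a * s * b ∈ TwoSidedIdeal.span S :=
    TwoSidedIdeal.mul_mem_right _ _ _ (TwoSidedIdeal.mul_mem_left _ _ _
      (TwoSidedIdeal.subset_span hs))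
  -- The recorded degree `j` of `s` may be less than `2` when `s = 0`, so it is replaced by a degree
  -- `m ≥ 2`.
  obtain ⟨m, hm, hsm⟩ := hS s hs
  exact Submodule.subset_span ⟨hmem, i + m + l, by omega, (ha.mul hsm).mul hb⟩

instance finite_range_ι_pow [Module.Finite k V] (n : ℕ) : Module.Finite k
    (LinearMap.range (TensorAlgebra.ι k : V →ₗ[k] TensorAlgebra k V) ^ n :
      Submodule k (TensorAlgebra k V)) :=
  Module.Finite.iff_fg.2 (Submodule.FG.pow (Module.Finite.iff_fg.1 inferInstance) n)

end Homogeneous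

/-! ### Images of ideals and Hopf ideals under the twist -/

variable [Finite G] {M : YDModule k G V} {N : YDModule k G W} {e : V ≃ₗ[k] W}

namespace IsDegInverting

variable (he : IsDegInverting M N e)

include he in
-- For `u` of degree `h`, `c(u b) = c(u) (h · c(b))` lies in `K`. A left factor `a` of degree `g`
-- would act on this by `g`, and `K` need not be `G`-stable; so the action is moved inside `c`,
-- where `g · u` remains in `U`.
theorem twist_mul_mem {U : Submodule k (TensorAlgebra k V)} (hU : M.tensor.IsSub U)
    {K : TwoSidedIdeal (TensorAlgebra k W)} (hK : ∀ u ∈ U, twist M N e u ∈ K)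
    {u : TensorAlgebra k V} (hu : u ∈ U) (a b : TensorAlgebra k V) :
    twist M N e (a * u * b) ∈ K := by
  have hr : ∀ b, ∀ u ∈ U, twist M N e (u * b) ∈ K := fun b =>
    le_of_isDeg (M := M.tensor) (U' := (toSub K).comap (twist M N e ∘ₗ LinearMap.mulRight k b))
      (fun g _ => hU.degProj_mem g) fun g u hu hg => by
        change twist M N e (u * b) ∈ K
        rw [twist_mul hg]
        exact K.mul_mem_right _ _ (hK u hu)
  induction a using M.tensor.isDeg_induction with
  | hdeg g a ha =>
    rw [mul_assoc, twist_mul ha, ← he.twist_act, map_mul]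
    exact K.mul_mem_left _ _ (hr _ _ (hU.act_mem g u hu))
  | hzero => simp [K.zero_mem]
  | hadd a b ha hb => rw [add_mul, add_mul, map_add]; exact K.add_mem ha hb
  | hsmul r a ha =>
    rw [smul_mul_assoc, smul_mul_assoc, map_smul]
    exact (toSub K).smul_mem r ha

/-- The image under `c` of an ideal which is a Yetter-Drinfeld submodule. -/
def twistIdeal {I : TwoSidedIdeal (TensorAlgebra k V)} (hI : M.tensor.IsSub (toSub I)) :
    TwoSidedIdeal (TensorAlgebra k W) :=
  TwoSidedIdeal.mk' ((toSub I).map (twist M N e) : Set (TensorAlgebra k W))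
    (Submodule.zero_mem _) (Submodule.add_mem _) (Submodule.neg_mem _)
    (fun {x y} hy => by
      obtain ⟨t, ht, rfl⟩ := hy
      induction x using N.tensor.isDeg_induction with
      | hdeg g x hx =>
        -- The left factor `c⁻¹(x)` has degree `g⁻¹`, so `t` is translated by `g` in advance to
        -- yield `x c(t)`.
        refine ⟨twist N M e.symm x * M.tensorAct g t, I.mul_mem_left _ _ (hI.act_mem g t ht), ?_⟩
        rw [twist_mul (he.symm.isDeg_twist hx), he.twist_act, tensorAct_inv_apply_self,
          he.twist_twist_symm]
      | hzero => rw [zero_mul]; exact Submodule.zero_mem _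
      | hadd a b ha hb => rw [add_mul]; exact Submodule.add_mem _ ha hb
      | hsmul r a ha => rw [smul_mul_assoc]; exact Submodule.smul_mem _ r ha)
    (fun {x y} hx => by
      obtain ⟨t, ht, rfl⟩ := hx
      refine le_of_isDeg (M := M.tensor) (U' := ((toSub I).map (twist M N e)).comap
        (LinearMap.mulRight k y ∘ₗ twist M N e)) (fun g _ => hI.degProj_mem g)
        (fun g u hu hg => ?_) ht
      -- Solves `c(u z) = c(u) (g · c(z)) = c(u) y` for `z`.
      refine ⟨u * twist N M e.symm (N.tensorAct g⁻¹ y), I.mul_mem_right _ _ hu, ?_⟩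
      rw [twist_mul hg, he.twist_twist_symm, tensorAct_apply_inv_self]
      rfl)

variable {I : TwoSidedIdeal (TensorAlgebra k V)} (hI : M.tensor.IsSub (toSub I))

theorem mem_twistIdeal {x : TensorAlgebra k W} :
    x ∈ he.twistIdeal hI ↔ ∃ t ∈ I, twist M N e t = x :=
  TwoSidedIdeal.mem_mk' _ _ _ _ _ _ x

theorem twist_mem_twistIdeal {t : TensorAlgebra k V} (ht : t ∈ I) :
    twist M N e t ∈ he.twistIdeal hI := (he.mem_twistIdeal hI).2 ⟨t, ht, rfl⟩

theorem isSub_twistIdeal : N.tensor.IsSub (toSub (he.twistIdeal hI)) := by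
  refine .of_degProj_mem (fun h x hx => ?_) fun g x hx => ?_
  · obtain ⟨t, ht, rfl⟩ := (he.mem_twistIdeal hI).1 hx
    exact (he.mem_twistIdeal hI).2 ⟨_, hI.act_mem h t ht, he.twist_act h t⟩
  · obtain ⟨t, ht, rfl⟩ := (he.mem_twistIdeal hI).1 hx
    exact (he.mem_twistIdeal hI).2 ⟨_, hI.degProj_mem g⁻¹ ht,
      (degProj_apply_of_isDeg_inv (fun _ _ => he.isDeg_twist) g t).symm⟩

theorem isGeneratedInDegreeGeTwo_twistIdeal (hgen : IsGeneratedInDegreeGeTwo I) :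
    IsGeneratedInDegreeGeTwo (he.twistIdeal hI) := by
  refine ⟨{x | x ∈ he.twistIdeal hI ∧ ∃ n, 2 ≤ n ∧ IsHomogeneous n x}, fun _ h => h.2,
    le_antisymm ?_ (TwoSidedIdeal.span_le.2 fun _ h => h.1)⟩
  intro x hx
  obtain ⟨t, ht, rfl⟩ := (he.mem_twistIdeal hI).1 hx
  refine (Submodule.span_le (p := (toSub (TwoSidedIdeal.span _)).comap (twist M N e))).2 ?_
    (hgen.toSub_le_span ht)
  rintro u ⟨hu, n, hn, hun⟩
  exact TwoSidedIdeal.subset_span ⟨he.twist_mem_twistIdeal hI hu, n, hn, hun.twist⟩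

/-- Since `c` reverses the coproduct, it exchanges `I ⊗ T` and `T ⊗ I`, leaving the coideal
condition intact. -/
theorem comul_mem_of_mem_twistIdeal (hcomul : ∀ x ∈ I, M.comul x ∈
      Submodule.map₂ (TensorProduct.mk k (TensorAlgebra k V) (TensorAlgebra k V)) (toSub I) ⊤ ⊔
      Submodule.map₂ (TensorProduct.mk k (TensorAlgebra k V) (TensorAlgebra k V)) ⊤ (toSub I))
    {x : TensorAlgebra k W} (hx : x ∈ he.twistIdeal hI) : N.comul x ∈
      Submodule.map₂ (TensorProduct.mk k (TensorAlgebra k W) (TensorAlgebra k W))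
        (toSub (he.twistIdeal hI)) ⊤ ⊔
      Submodule.map₂ (TensorProduct.mk k (TensorAlgebra k W) (TensorAlgebra k W)) ⊤
        (toSub (he.twistIdeal hI)) := by
  obtain ⟨t, ht, rfl⟩ := (he.mem_twistIdeal hI).1 hx
  rw [he.comul_twist]
  suffices h : Submodule.map₂ (TensorProduct.mk k (TensorAlgebra k V) (TensorAlgebra k V))
        (toSub I) ⊤ ⊔
      Submodule.map₂ (TensorProduct.mk k (TensorAlgebra k V) (TensorAlgebra k V)) ⊤ (toSub I) ≤
      (Submodule.map₂ (TensorProduct.mk k (TensorAlgebra k W) (TensorAlgebra k W))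
        (toSub (he.twistIdeal hI)) ⊤ ⊔
      Submodule.map₂ (TensorProduct.mk k (TensorAlgebra k W) (TensorAlgebra k W)) ⊤
        (toSub (he.twistIdeal hI))).comap (TensorProduct.map (twist M N e) (twist M N e) ∘ₗ
          (TensorProduct.comm k (TensorAlgebra k V) (TensorAlgebra k V)).toLinearMap) from
    h (hcomul t ht)
  refine sup_le ?_ ?_
  · rw [Submodule.map₂_le]
    intro a ha b _
    exact Submodule.mem_sup_right (Submodule.apply_mem_map₂ _ Submodule.mem_top
      (he.twist_mem_twistIdeal hI ha))
  · rw [Submodule.map₂_le]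
    intro a _ b hb
    exact Submodule.mem_sup_left (Submodule.apply_mem_map₂ _ (he.twist_mem_twistIdeal hI hb)
      Submodule.mem_top)

include he in
theorem antipode_injective : Function.Injective M.antipode := fun a b h =>
  he.twist_injective (by rw [← he.antipode_twist_antipode, h, he.antipode_twist_antipode])

include he in
-- The antipode restricts to an injective endomorphism of the finite-dimensional space `I ∩ V^{⊗
-- n}`, hence a surjective one.
theorem exists_antipode_eq [Module.Finite k V] (hS : ∀ x ∈ I, M.antipode x ∈ I) {n : ℕ}
    {x : TensorAlgebra k V} (hx : x ∈ I) (hn : IsHomogeneous n x) :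
    ∃ y ∈ I, M.antipode y = x := by
  let U : Submodule k (TensorAlgebra k V) :=
    toSub I ⊓ LinearMap.range (TensorAlgebra.ι k : V →ₗ[k] TensorAlgebra k V) ^ n
  have : Module.Finite k U := Submodule.finiteDimensional_inf_right _ _
  let f : U →ₗ[k] U := M.antipode.restrict fun y hy => ⟨hS y hy.1, IsHomogeneous.antipode hy.2⟩
  have hf : Function.Injective f := fun a b h =>
    Subtype.ext (he.antipode_injective (congrArg Subtype.val h))
  obtain ⟨y, hy⟩ := LinearMap.injective_iff_surjective.1 hf ⟨x, hx, hn⟩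
  exact ⟨y, y.2.1, congrArg Subtype.val hy⟩

theorem isHopfIdeal_twistIdeal [Module.Finite k V] (hH : M.IsHopfIdeal I)
    (hgen : IsGeneratedInDegreeGeTwo I) : N.IsHopfIdeal (he.twistIdeal hH.isSub) where
  isSub := he.isSub_twistIdeal hH.isSub
  comul_mem _ := he.comul_mem_of_mem_twistIdeal hH.isSub hH.comul_mem
  counit_eq_zero x hx := by
    obtain ⟨t, ht, rfl⟩ := (he.mem_twistIdeal hH.isSub).1 hx
    rw [algebraMapInv_twist, hH.counit_eq_zero t ht]
  antipode_mem x hx := by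
    obtain ⟨t, ht, rfl⟩ := (he.mem_twistIdeal hH.isSub).1 hx
    refine (Submodule.span_le (p := (toSub (he.twistIdeal hH.isSub)).comap
      (N.antipode ∘ₗ twist M N e))).2 ?_ (hgen.toSub_le_span ht)
    rintro u ⟨hu, n, -, hn⟩
    -- With `u = S(y)`, the identity `S c S = c` turns `S(c(u))` into `c(y)`.
    obtain ⟨y, hy, rfl⟩ := he.exists_antipode_eq hH.antipode_mem hu hn
    change N.antipode (twist M N e (M.antipode y)) ∈ he.twistIdeal hH.isSub
    rw [he.antipode_twist_antipode]
    exact he.twist_mem_twistIdeal _ hy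

include he in
theorem twist_mem_nicholsIdeal [Module.Finite k V] {t : TensorAlgebra k V}
    (ht : t ∈ M.nicholsIdeal) : twist M N e t ∈ N.nicholsIdeal := by
  obtain ⟨hH, hgen⟩ := M.isGreatest_nicholsIdeal.1
  exact N.isGreatest_nicholsIdeal.2 ⟨he.isHopfIdeal_twistIdeal hH hgen,
    he.isGeneratedInDegreeGeTwo_twistIdeal hH.isSub hgen⟩ (he.twist_mem_twistIdeal _ ht)

include he in
-- The inclusion of the Nichols ideals applied to both `e` and `e.symm`, whose twists are mutually
-- inverse.
theorem mem_nicholsIdeal_iff [Module.Finite k V] {x : TensorAlgebra k W} :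
    x ∈ N.nicholsIdeal ↔ ∃ t ∈ M.nicholsIdeal, twist M N e t = x := by
  have : Module.Finite k W := Module.Finite.equiv e
  exact ⟨fun hx => ⟨_, he.symm.twist_mem_nicholsIdeal hx, he.twist_twist_symm x⟩,
    fun ⟨t, ht, h⟩ => h ▸ he.twist_mem_nicholsIdeal ht⟩

/-! ### Images of generating sets -/

include he in
theorem twist_mem_span_image_of_isHomogeneous {S : Set (TensorAlgebra k V)}
    (hS : ∀ s ∈ S, ∃ n, IsHomogeneous n s) (hI : M.tensor.IsSub (toSub (TwoSidedIdeal.span S)))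
    {t : TensorAlgebra k V} (ht : t ∈ TwoSidedIdeal.span S) :
    twist M N e t ∈ TwoSidedIdeal.span (twist M N e '' S) := by
  have hK : ∀ s ∈ S, twist M N e s ∈ TwoSidedIdeal.span (twist M N e '' S) :=
    fun s hs => TwoSidedIdeal.subset_span ⟨s, hs, rfl⟩
  have key : ∀ n, ∀ x ∈ TwoSidedIdeal.span S, IsHomogeneous n x →
      twist M N e x ∈ TwoSidedIdeal.span (twist M N e '' S) := by
    intro n
    induction n using Nat.strong_induction_on with
    | _ n ih =>
      intro x hx hn
      refine (Submodule.span_le (p := (toSub (TwoSidedIdeal.span (twist M N e '' S))).comap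
        (twist M N e))).2 ?_ (hn.mem_span_of_mem_span hS hx)
      rintro _ ⟨i, j, l, a, s, b, ha, hj, hb, hs, rfl, rfl⟩
      -- If `j` is below the total degree, the induction hypothesis puts the image of the whole
      -- degree `j` part of the ideal, a Yetter-Drinfeld submodule containing `s`, into the target.
      -- Otherwise `a` and `b` are scalars and `c(s)` itself suffices.
      by_cases hjn : j < i + j + l
      · exact he.twist_mul_mem (hI.inf (M.isSub_range_ι_pow j)) (fun u hu => ih j hjn u hu.1 hu.2)
          ⟨TwoSidedIdeal.subset_span hs, hj⟩ a b
      · obtain rfl : i = 0 := by omega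
        obtain rfl : l = 0 := by omega
        unfold IsHomogeneous at ha hb
        rw [pow_zero, Submodule.mem_one] at ha hb
        obtain ⟨r, rfl⟩ := ha
        obtain ⟨r', rfl⟩ := hb
        rw [← Algebra.commutes, ← Algebra.smul_def, ← Algebra.smul_def]
        exact Submodule.smul_mem _ _ (Submodule.smul_mem _ _ (hK s hs))
  refine (Submodule.span_le (p := (toSub (TwoSidedIdeal.span (twist M N e '' S))).comap
    (twist M N e))).2 ?_ (toSub_span_le_span hS ht)
  rintro x ⟨n, hx⟩
  have hmem : x ∈ TwoSidedIdeal.span S := by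
    obtain ⟨i, j, l, a, s, b, -, -, -, hs, -, rfl⟩ := hx
    exact TwoSidedIdeal.mul_mem_right _ _ _ (TwoSidedIdeal.mul_mem_left _ _ _
      (TwoSidedIdeal.subset_span hs))
  exact key n x hmem hx.isHomogeneous

include he in
theorem twist_mem_span_image_of_isSub {S : Set (TensorAlgebra k V)}
    (hS : M.tensor.IsSub (Submodule.span k S)) {t : TensorAlgebra k V}
    (ht : t ∈ TwoSidedIdeal.span S) :
    twist M N e t ∈ TwoSidedIdeal.span (twist M N e '' S) := by
  have hK : Submodule.span k S ≤ (toSub (TwoSidedIdeal.span (twist M N e '' S))).comap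
      (twist M N e) :=
    Submodule.span_le.2 fun s hs => TwoSidedIdeal.subset_span ⟨s, hs, rfl⟩
  exact toSub_span_le (U := (toSub (TwoSidedIdeal.span (twist M N e '' S))).comap (twist M N e))
    (fun a b _ hs => Submodule.mem_comap.2
      (he.twist_mul_mem hS
        (K := TwoSidedIdeal.span (twist M N e '' S)) (fun _ hu => hK hu) (Submodule.subset_span hs) a b)) ht

include he in
theorem span_image_eq_nicholsIdeal [Module.Finite k V] {S : Set (TensorAlgebra k V)}
    (hS : (∀ s ∈ S, ∃ n, IsHomogeneous n s) ∨ M.tensor.IsSub (Submodule.span k S))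
    (hspan : TwoSidedIdeal.span S = M.nicholsIdeal) :
    TwoSidedIdeal.span (twist M N e '' S) = N.nicholsIdeal := by
  apply le_antisymm
  · rw [TwoSidedIdeal.span_le]
    rintro _ ⟨s, hs, rfl⟩
    exact he.twist_mem_nicholsIdeal (hspan ▸ TwoSidedIdeal.subset_span hs)
  · intro x hx
    obtain ⟨t, ht, rfl⟩ := he.mem_nicholsIdeal_iff.1 hx
    rw [← hspan] at ht
    rcases hS with hS | hS
    · refine he.twist_mem_span_image_of_isHomogeneous hS ?_ ht
      rw [hspan]
      exact M.isGreatest_nicholsIdeal.1.1.isSub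
    · exact he.twist_mem_span_image_of_isSub hS ht

include he in
theorem ydSpan_image_eq_nicholsIdeal [Module.Finite k V] {S : Set (TensorAlgebra k V)}
    (hspan : M.ydSpan S = M.nicholsIdeal) :
    N.ydSpan (twist M N e '' S) = N.nicholsIdeal := by
  apply le_antisymm
  · refine sInf_le ⟨N.isGreatest_nicholsIdeal.1.1.isSub, ?_⟩
    rintro _ ⟨s, hs, rfl⟩
    refine he.twist_mem_nicholsIdeal ?_
    rw [← hspan]
    exact (le_sInf fun I hI => TwoSidedIdeal.span_le.2 hI.2 :
      TwoSidedIdeal.span S ≤ M.ydSpan S) (TwoSidedIdeal.subset_span hs)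
  · refine le_sInf fun K hK x hx => ?_
    obtain ⟨t, ht, rfl⟩ := he.mem_nicholsIdeal_iff.1 hx
    rw [← hspan] at ht
    -- The preimage of `K` under `c` is its image under the inverse twist, hence a Yetter-Drinfeld
    -- ideal containing `S`.
    have hle : M.ydSpan S ≤ he.symm.twistIdeal hK.1 := sInf_le
      ⟨he.symm.isSub_twistIdeal hK.1, fun s hs => (he.symm.mem_twistIdeal hK.1).2
        ⟨twist M N e s, hK.2 ⟨s, hs, rfl⟩, he.twist_twist s⟩⟩
    obtain ⟨y, hy, rfl⟩ := (he.symm.mem_twistIdeal hK.1).1 (hle ht)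
    rwa [he.twist_twist_symm]

end IsDegInverting

end YDModule

/-! ### Application to principal realizations of racks -/

namespace PrincipalRealization

variable {k X G : Type*} [Field k] [Rack X] [Group G] {q : X → X → kˣ}
  (R : PrincipalRealization G q)

theorem isDegInverting [Finite G] : YDModule.IsDegInverting R.toYD R.dual.toYD
    (Finsupp.domLCongr MulOpposite.opEquiv : (X →₀ k) ≃ₗ[k] (Xᵐᵒᵖ →₀ k)) where
  act h v := by
    refine LinearMap.congr_fun (f := (Finsupp.domLCongr MulOpposite.opEquiv).toLinearMap ∘ₗ
      R.toYD.act h) (g := R.dual.toYD.act h ∘ₗ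
        (Finsupp.domLCongr MulOpposite.opEquiv).toLinearMap) ?_ v
    ext i : 2
    simp [toYD, dual]
  isDeg g v hv := by
    have h := LinearMap.congr_fun (f := R.dual.toYD.coact ∘ₗ
      (Finsupp.domLCongr MulOpposite.opEquiv).toLinearMap)
      -- The antipode of `kG` inverts group elements, so degree inversion becomes a linear identity
      -- that can be checked on the basis `x_i`.
      (g := TensorProduct.map (HopfAlgebra.antipode k (A := MonoidAlgebra k G))
        (Finsupp.domLCongr MulOpposite.opEquiv).toLinearMap ∘ₗ R.toYD.coact)
      (by ext i : 2; simp [toYD, dual]) v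
    simp only [LinearMap.comp_apply, LinearEquiv.coe_coe] at h
    unfold YDModule.IsDeg at hv ⊢
    rw [h, hv]
    simp

theorem frakC_eq_twist [Finite G] : R.frakC = YDModule.twist R.toYD R.dual.toYD
    (Finsupp.domLCongr MulOpposite.opEquiv : (X →₀ k) ≃ₗ[k] (Xᵐᵒᵖ →₀ k)) := by
  ext t
  induction t using R.x_induction with
  | hone => rw [frakC_one, YDModule.twist_one]
  | hmul i g t _ ht =>
    have hd : R.toYD.IsDeg (R.g i) (Finsupp.single i 1) := by simp [YDModule.IsDeg, toYD]
    rw [frakC_x_mul, ht, show R.x i = TensorAlgebra.ι k (Finsupp.single i 1) from rfl,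
      YDModule.twist_ι_mul hd]
    simp [x]
  | hadd a b ha hb => rw [map_add, map_add, ha, hb]
  | hsmul a m hm => rw [map_smul, map_smul, hm]

end PrincipalRealization

end

end NicholsRack

theorem mainTheorem11 {k : Type*} [Field k] [IsAlgClosed k] [CharZero k]
    {G : Type*} [Group G] [Finite G] {X : Type*} [Rack X] [Nonempty X]
    (q : X → X → kˣ) (_hq : NicholsRack.IsTwoCocycle q)
    (R : NicholsRack.PrincipalRealization G q) :
    (R.dual.J : Set (TensorAlgebra k (Xᵐᵒᵖ →₀ k))) =
        R.frakC '' (R.J : Set (TensorAlgebra k (X →₀ k))) ∧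
      (∀ S : Set (TensorAlgebra k (X →₀ k)),
        (∀ s ∈ S, ∃ n, NicholsRack.YDModule.IsHomogeneous n s) ∨
            R.toYD.tensor.IsSub (Submodule.span k S) →
          TwoSidedIdeal.span S = R.J → TwoSidedIdeal.span (R.frakC '' S) = R.dual.J) ∧
      (∀ S : Set (TensorAlgebra k (X →₀ k)),
        R.toYD.ydSpan S = R.J → R.dual.toYD.ydSpan (R.frakC '' S) = R.dual.J) := by
  -- Faithfulness makes `V(X, q)` finite-dimensional, as the surjectivity of the antipode on graded
  -- pieces requires.
  have : Finite X := Finite.of_injective R.g R.injective_g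
  have he := R.isDegInverting
  rw [R.frakC_eq_twist]
  exact ⟨Set.ext fun _ => he.mem_nicholsIdeal_iff, fun _ => he.span_image_eq_nicholsIdeal,
    fun _ => he.ydSpan_image_eq_nicholsIdeal⟩
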